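/- Let $H$ be a real separable Hilbert space with norm $|\cdot|$ and inner product $(\cdot,\cdot)$, let $\overline D$ be its closed unit ball and $\pi$ the projection onto $\overline D$: $\pi(y)=y$ if $|y|\le 1$ and $\pi(y)=y/|y|$ if $|y|>1$. Let $A$ be a self-adjoint operator on $H$ with $(Au,u)\ge\lambda_1|u|^2$ for all $u\in D(A)$ and some $\lambda_1>0$. Put $V=D(A^{1/2})$ with $((u,v))=(A^{1/2}u,A^{1/2}v)$ and norm $\|\cdot\|$, so that $V\hookrightarrow H=H^*\hookrightarrow V^*$, and $A$ acts as a bounded operator $V\to V^*$ by $\langle Au,v\rangle=((u,v))$. Assume: (A.1) $f:H\to V^*$ and $\sigma:H\to H$ satisfy $|f(u)-f(v)|_{V^*}+|\sigma(u)-\sigma(v)|\le C|u-v|$ for all $u,v\in H$ and some constant $C$. (A.2) $B:V\times V\to V^*$ is bilinear, and for all $u,v,w\in V$ one has $\langle B(u,v),w\rangle=-\langle B(u,w),v\rangle$ and $|\langle B(u,v),w\rangle|\le c\,\|u\|^{1/2}|u|^{1/2}\|w\|^{1/2}|w|^{1/2}\|v\|$, for some constant $c>0$. (A.3) $u_0\in\overline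 D$. Let $T>0$, $K=L^2([0,T];\mathbb R)$, $S_N=\{k\in K:\int_0^Tk(s)^2\,ds\le N\}$, and $X_T=C([0,T];H)\cap L^2([0,T];V)$ with $|u|_{X_T}^2=\sup_{t\in[0,T]}|u(t)|^2+\int_0^T\|u(s)\|^2ds$. For $k\in K$ and $n\in\mathbb N$, a solution $u^{k,n}$ of the penalized equation is an element of $X_T$ with $u^{k,n}(0)=u_0$ such that, for all $t\in[0,T]$, in $V^*$ (writing $u=u^{k,n}$), $$u(t)+\int_0^tAu\,ds=u_0+\int_0^tf(u)\,ds+\int_0^tB(u,u)\,ds+\int_0^t\sigma(u)k\,ds-n\int_0^t(u-\pi(u))\,ds.$$ A solution $(u^k,L^k)$ of the reflected equation consists of a $\overline D$-valued $u^k\in X_T$ with $u^k(0)=u_0$ and a continuous $L^k:[0,T]\to H$ of bounded variation with $L^k(0)=0$ such that, for all $t\in[0,T]$, in $V^*$ (writing $u=u^k$), $$u(t)+\int_0^tAu\,ds=u_0+\int_0^tf(u)\,ds+\int_0^tB(u,u)\,ds+\int_0^t\sigma(u)k\,ds+L^k(t),$$ and $\int_0^T(\phi(t)-u^k(t),L^k(dt))\ge0$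 (Riemann–Stieltjes integral) for every $\phi\in C([0,T];\overline D)$. Then for every $N>0$ $$\lim_{n\to\infty}\ \sup_{k\in S_N}|u^{k,n}-u^k|_{X_T}=0,$$ where the supremum is taken over all $k\in S_N$ and all solutions $u^{k,n}$ and $(u^k,L^k)$ of the two equations for this $k$. -/

import Mathlib

open MeasureTheory Set Filter Topology
open scoped ENNReal InnerProductSpace

noncomputable section

namespace ReflectedSEE

variable {H : Type*} [NormedAddCommGroup H] [InnerProductSpace ℝ H] [CompleteSpace H]

/-! ### The operator `A`, its square root and the Gelfand triple -/

/-- `S` is the nonnegative self-adjoint square root `A^{1/2}` of `A`: the operator `S` is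
self-adjoint and nonnegative, and `A = S ∘ S` as unbounded operators (equality of domains and of
values). A nonnegative self-adjoint operator has exactly one such square root. -/
structure IsPosSqrt (A S : H →ₗ.[ℝ] H) : Prop where
  isSelfAdjoint : IsSelfAdjoint S
  nonneg : ∀ u : S.domain, 0 ≤ ⟪S u, (u : H)⟫_ℝ
  mem_domain_iff : ∀ u : H, u ∈ A.domain ↔ ∃ h : u ∈ S.domain, S ⟨u, h⟩ ∈ S.domain
  apply_eq : ∀ (u : S.domain) (hS : S u ∈ S.domain) (hA : (u : H) ∈ A.domain),
    A ⟨u, hA⟩ = S ⟨S u, hS⟩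

variable (H) in
/-- A (possibly unbounded) self-adjoint operator `A` on `H` such that, for some `λ₁ > 0`,
`(A u, u) ≥ λ₁ |u|²` on `D(A)`. -/
structure CoerciveOperator where
  A : H →ₗ.[ℝ] H
  isSelfAdjoint : IsSelfAdjoint A
  coercive : ∃ l : ℝ, 0 < l ∧ ∀ u : A.domain, l * ‖(u : H)‖ ^ 2 ≤ ⟪A u, (u : H)⟫_ℝ

/-- The polynomials `p₀ = 0`, `p_{n+1} = (X + p_n²) / 2`. -/
def sqrtPoly : ℕ → Polynomial ℝ
  | 0 => 0
  | n + 1 => Polynomial.C (1 / 2 : ℝ) * (Polynomial.X + sqrtPoly n ^ 2)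

theorem coeff_mul_nonneg {p q : Polynomial ℝ} (hp : ∀ i, 0 ≤ p.coeff i)
    (hq : ∀ i, 0 ≤ q.coeff i) (i : ℕ) : 0 ≤ (p * q).coeff i := by
  rw [Polynomial.coeff_mul]
  exact Finset.sum_nonneg fun x _ => mul_nonneg (hp _) (hq _)

theorem sqrtPoly_coeff_nonneg (n i : ℕ) : 0 ≤ (sqrtPoly n).coeff i := by
  induction n generalizing i with
  | zero => simp [sqrtPoly]
  | succ n ih =>
    rw [sqrtPoly, Polynomial.coeff_C_mul, Polynomial.coeff_add, Polynomial.coeff_X, sq]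
    have := coeff_mul_nonneg ih ih i
    split_ifs <;> linarith

theorem sqrtPoly_diff_coeff_nonneg (n i : ℕ) :
    0 ≤ (sqrtPoly (n + 1) - sqrtPoly n).coeff i := by
  induction n generalizing i with
  | zero =>
    have := sqrtPoly_coeff_nonneg 1 i
    simpa [sqrtPoly] using this
  | succ n ih =>
    have e : sqrtPoly (n + 1 + 1) - sqrtPoly (n + 1) = Polynomial.C (1 / 2 : ℝ) *
        ((sqrtPoly (n + 1) + sqrtPoly n) * (sqrtPoly (n + 1) - sqrtPoly n)) := by
      rw [sqrtPoly.eq_2 (n + 1)]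
      conv_lhs => rw [sub_eq_add_neg]; arg 2; rw [sqrtPoly.eq_2 n]
      ring
    rw [e, Polynomial.coeff_C_mul]
    refine mul_nonneg (by norm_num) (coeff_mul_nonneg (fun j => ?_) ih i)
    rw [Polynomial.coeff_add]
    exact add_nonneg (sqrtPoly_coeff_nonneg _ _) (sqrtPoly_coeff_nonneg _ _)

theorem sqrtPoly_eval_one_le (n : ℕ) : 0 ≤ (sqrtPoly n).eval 1 ∧ (sqrtPoly n).eval 1 ≤ 1 := by
  induction n with
  | zero => simp [sqrtPoly]
  | succ n ih =>
    simp only [sqrtPoly, Polynomial.eval_mul, Polynomial.eval_C, Polynomial.eval_add,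
      Polynomial.eval_X, Polynomial.eval_pow]
    constructor <;> nlinarith [ih.1, ih.2]

theorem norm_aeval_le {C : H →L[ℝ] H} (hC : ‖C‖ ≤ 1) {p : Polynomial ℝ}
    (hp : ∀ i, 0 ≤ p.coeff i) : ‖Polynomial.aeval C p‖ ≤ p.eval 1 := by
  rw [Polynomial.aeval_eq_sum_range, Polynomial.eval_eq_sum_range]
  refine (norm_sum_le _ _).trans (Finset.sum_le_sum fun i _ => ?_)
  rw [norm_smul, Real.norm_of_nonneg (hp i)]
  refine mul_le_mul_of_nonneg_left ?_ (hp i)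
  rw [one_pow]
  clear * - hC
  induction i with
  | zero => rw [pow_zero]; exact ContinuousLinearMap.norm_id_le
  | succ i ih =>
    rw [pow_succ]
    exact (norm_mul_le _ _).trans (mul_le_one₀ ih (norm_nonneg _) hC)

theorem smul_isSelfAdjoint {G : H →L[ℝ] H} (hG : IsSelfAdjoint G) (r : ℝ) :
    IsSelfAdjoint (r • G) := by
  rw [ContinuousLinearMap.isSelfAdjoint_iff_isSymmetric] at hG ⊢
  intro x y
  have h1 : ⟪G x, y⟫_ℝ = ⟪x, G y⟫_ℝ := hG x y
  change ⟪r • G x, y⟫_ℝ = ⟪x, r • G y⟫_ℝ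
  rw [real_inner_smul_left, real_inner_smul_right, h1]

/-- If `C` is a self-adjoint contraction, then `1 - C` has a nonnegative self-adjoint square root. -/
theorem exists_sqrt_one_sub {C : H →L[ℝ] H} (hC : ‖C‖ ≤ 1) (hsa : IsSelfAdjoint C) :
    ∃ R : H →L[ℝ] H, IsSelfAdjoint R ∧ (∀ x, 0 ≤ ⟪R x, x⟫_ℝ) ∧ R * R = 1 - C := by
  let Y : ℕ → H →L[ℝ] H := fun n => Polynomial.aeval C (sqrtPoly n)
  have hYsa : ∀ n, IsSelfAdjoint (Y n) := by
    intro n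
    induction n with
    | zero => simp [Y, sqrtPoly]
    | succ n ih =>
      have : Y (n + 1) = (1 / 2 : ℝ) • (C + Y n ^ 2) := by
        simp [Y, sqrtPoly, Algebra.smul_def]
      rw [this]
      exact smul_isSelfAdjoint (hsa.add (ih.pow 2)) _
  have hY1 : ∀ n, ‖Y n‖ ≤ 1 := fun n =>
    (norm_aeval_le hC (sqrtPoly_coeff_nonneg n)).trans (sqrtPoly_eval_one_le n).2
  have hstep : ∀ n, ‖Y n - Y (n + 1)‖ ≤
      (sqrtPoly (n + 1)).eval 1 - (sqrtPoly n).eval 1 := by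
    intro n
    rw [← norm_neg, neg_sub, ← Polynomial.eval_sub]
    simp only [Y, ← map_sub]
    exact norm_aeval_le hC (sqrtPoly_diff_coeff_nonneg n)
  have hcau : CauchySeq Y := by
    refine cauchySeq_of_summable_dist ?_
    refine summable_of_sum_range_le (c := 1) (fun _ => dist_nonneg) fun n => ?_
    calc ∑ i ∈ Finset.range n, dist (Y i) (Y (i + 1))
        ≤ ∑ i ∈ Finset.range n, ((sqrtPoly (i + 1)).eval 1 - (sqrtPoly i).eval 1) :=
          Finset.sum_le_sum fun i _ => by rw [dist_eq_norm]; exact hstep i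
      _ = (sqrtPoly n).eval 1 - (sqrtPoly 0).eval 1 :=
          Finset.sum_range_sub (fun i => (sqrtPoly i).eval 1) n
      _ ≤ 1 := by
          have := (sqrtPoly_eval_one_le n).2
          simpa [sqrtPoly] using this
  obtain ⟨X, hX⟩ := cauchySeq_tendsto_of_complete hcau
  have hX1 : ‖X‖ ≤ 1 := le_of_tendsto hX.norm (Eventually.of_forall hY1)
  have hXsa : IsSelfAdjoint X := by
    have h1 : Tendsto (fun n => star (Y n)) atTop (𝓝 (star X)) := hX.star
    have h2 : (fun n => star (Y n)) = Y := funext fun n => (hYsa n).star_eq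
    rw [h2] at h1
    exact tendsto_nhds_unique h1 hX
  have hXeq : X = (1 / 2 : ℝ) • (C + X ^ 2) := by
    have h1 : Tendsto (fun n => Y (n + 1)) atTop (𝓝 X) := (tendsto_add_atTop_iff_nat 1).2 hX
    have h2 : Tendsto (fun n => (1 / 2 : ℝ) • (C + Y n ^ 2)) atTop
        (𝓝 ((1 / 2 : ℝ) • (C + X ^ 2))) := ((hX.pow 2).const_add C).const_smul _
    refine tendsto_nhds_unique h1 (h2.congr fun n => ?_)
    simp [Y, sqrtPoly, Algebra.smul_def]
  refine ⟨1 - X, (IsSelfAdjoint.one _).sub hXsa, fun x => ?_, ?_⟩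
  · have h1 : ⟪X x, x⟫_ℝ ≤ ‖x‖ * ‖x‖ := (real_inner_le_norm _ _).trans
      (mul_le_mul_of_nonneg_right ((X.le_opNorm x).trans
        (mul_le_of_le_one_left (norm_nonneg _) hX1)) (norm_nonneg _))
    have h2 : (1 - X) x = x - X x := rfl
    rw [h2, inner_sub_left, real_inner_self_eq_norm_mul_norm]
    linarith
  · have h1 : (2 : ℝ) • X = C + X ^ 2 := by
      conv_lhs => rw [hXeq]
      rw [smul_smul]; norm_num
    have h2 : X + X = C + X ^ 2 := by rw [← two_smul ℝ X, h1]
    have h3 : (1 - X) * (1 - X) = 1 - (X + X) + X ^ 2 := by noncomm_ring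
    rw [h3, h2]; abel

/-- If `R` is bounded, self-adjoint, nonnegative and injective, then its inverse (with the range of
`R` as its domain) is self-adjoint and nonnegative. -/
theorem inverse_isSelfAdjoint {R : H →L[ℝ] H} (hsa : IsSelfAdjoint R) (S : H →ₗ.[ℝ] H)
    (hdom : ∀ u, u ∈ S.domain ↔ ∃ x, R x = u) (hRS : ∀ u : S.domain, R (S u) = u)
    (hSR : ∀ (x : H) (h : R x ∈ S.domain), S ⟨R x, h⟩ = x) : IsSelfAdjoint S := by
  have hsymm : ∀ x y, ⟪R x, y⟫_ℝ = ⟪x, R y⟫_ℝ := fun x y => hsa.isSymmetric x y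
  have hmem : ∀ x, R x ∈ S.domain := fun x => (hdom _).2 ⟨x, rfl⟩
  have hdense : Dense (S.domain : Set H) := by
    rw [Submodule.dense_iff_topologicalClosure_eq_top, Submodule.topologicalClosure_eq_top_iff,
      Submodule.eq_bot_iff]
    intro y hy
    have h0 : R y = 0 := by
      have h1 : ⟪R (R y), y⟫_ℝ = 0 := (Submodule.mem_orthogonal _ y).1 hy _ (hmem _)
      rw [hsymm] at h1
      exact inner_self_eq_zero.1 h1
    rw [← hSR y (hmem y)]
    have : (⟨R y, hmem y⟩ : S.domain) = 0 := Subtype.ext h0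
    rw [this, LinearPMap.map_zero]
  rw [LinearPMap.isSelfAdjoint_def]
  have hform : S.IsFormalAdjoint S := by
    intro u v
    conv_rhs => rw [← hRS u]
    rw [hsymm, hRS v]
  have hle : S ≤ S.adjoint := hform.le_adjoint hdense
  refine (LinearPMap.eq_of_le_of_domain_eq hle (le_antisymm hle.1 fun y hy => ?_)).symm
  rw [hdom]
  refine ⟨S.adjoint ⟨y, hy⟩, ext_inner_right ℝ fun x => ?_⟩
  have h1 := LinearPMap.adjoint_isFormalAdjoint hdense ⟨y, hy⟩ ⟨R x, hmem x⟩
  rw [hSR] at h1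
  rw [hsymm]
  exact h1

/-- A self-adjoint operator is symmetric. -/
theorem symm_of_isSelfAdjoint {S : H →ₗ.[ℝ] H} (hS : IsSelfAdjoint S) (u v : S.domain) :
    ⟪S u, (v : H)⟫_ℝ = ⟪(u : H), S v⟫_ℝ := by
  have h := LinearPMap.adjoint_isFormalAdjoint (T := S) hS.dense_domain
  rw [LinearPMap.isSelfAdjoint_def.mp hS] at h
  exact h u v

namespace CoerciveOperator

variable (𝔸 : CoerciveOperator H)

/-- A self-adjoint coercive operator is onto. -/
theorem surjective_A (h : H) : ∃ u : 𝔸.A.domain, 𝔸.A u = h := by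
  obtain ⟨l, hl, hc⟩ := 𝔸.coercive
  have hb : ∀ u : 𝔸.A.domain, l * ‖(u : H)‖ ≤ ‖𝔸.A u‖ := by
    intro u
    rcases eq_or_lt_of_le (norm_nonneg (u : H)) with h0 | h0
    · rw [← h0]; simp
    · have := (hc u).trans (real_inner_le_norm _ _)
      nlinarith
  let R : Submodule ℝ H := LinearMap.range 𝔸.A.toFun
  have hR : IsClosed (R : Set H) := by
    rw [← isSeqClosed_iff_isClosed]
    intro x y hx hy
    choose u hu using hx
    have hcau : CauchySeq (fun n => ((u n : H))) := by
      rw [Metric.cauchySeq_iff']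
      intro ε hε
      obtain ⟨n, hn⟩ := Metric.cauchySeq_iff'.1 hy.cauchySeq (l * ε) (by positivity)
      refine ⟨n, fun m hm => ?_⟩
      have h1 := hn m hm
      have h2 := hb (u m - u n)
      rw [LinearPMap.map_sub] at h2
      have e1 : 𝔸.A (u m) = x m := hu m
      have e2 : 𝔸.A (u n) = x n := hu n
      rw [e1, e2, ← dist_eq_norm (x m)] at h2
      rw [dist_eq_norm]
      have h3 := h2.trans_lt h1
      exact lt_of_mul_lt_mul_left (by simpa using h3) hl.le
    obtain ⟨v, hv⟩ := cauchySeq_tendsto_of_complete hcau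
    have hcl : IsClosed (𝔸.A.graph : Set (H × H)) := 𝔸.isSelfAdjoint.isClosed
    have hmem : (v, y) ∈ (𝔸.A.graph : Set (H × H)) := by
      refine hcl.mem_of_tendsto (hv.prodMk_nhds hy) (Eventually.of_forall fun n => ?_)
      have e1 : 𝔸.A (u n) = x n := hu n
      rw [← e1]
      exact 𝔸.A.mem_graph (u n)
    obtain ⟨w, -, hw⟩ := (𝔸.A.mem_graph_iff).1 hmem
    exact ⟨w, hw⟩
  have hO : Rᗮ = ⊥ := by
    rw [Submodule.eq_bot_iff]
    intro y hy
    have hz : ∀ x : 𝔸.A.domain, ⟪(0 : H), (x : H)⟫_ℝ = ⟪y, 𝔸.A x⟫_ℝ := by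
      intro x
      rw [inner_zero_left]
      exact ((Submodule.mem_orthogonal' R y).1 hy _ ⟨x, rfl⟩).symm
    have hd : y ∈ 𝔸.A.domain := by
      have := LinearPMap.mem_adjoint_domain_of_exists (T := 𝔸.A) y ⟨0, hz⟩
      rwa [LinearPMap.isSelfAdjoint_def.mp 𝔸.isSelfAdjoint] at this
    have h1 : ⟪𝔸.A ⟨y, hd⟩, y⟫_ℝ = 0 := by
      rw [real_inner_comm]
      exact (hz ⟨y, hd⟩).symm.trans (inner_zero_left _)
    have h2 := hc ⟨y, hd⟩
    rw [h1] at h2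
    have h3 : ‖y‖ ^ 2 = 0 := le_antisymm (by nlinarith [sq_nonneg ‖y‖]) (sq_nonneg _)
    simpa using h3
  have : CompleteSpace R := hR.completeSpace_coe
  have hT : R = ⊤ := by
    rwa [Submodule.orthogonal_eq_bot_iff] at hO
  have : h ∈ R := by rw [hT]; trivial
  exact this

/-- The positive self-adjoint square root exists. -/
theorem exists_isPosSqrt : ∃ S : H →ₗ.[ℝ] H, IsPosSqrt 𝔸.A S := by
  obtain ⟨l, hl, hc⟩ := 𝔸.coercive
  have hinj : Function.Injective 𝔸.A.toFun := by
    rw [← LinearMap.ker_eq_bot, LinearMap.ker_eq_bot']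
    intro u hu
    have h1 : 𝔸.A u = 0 := hu
    have h2 := hc u
    rw [h1, inner_zero_left] at h2
    have h3 : ‖(u : H)‖ ^ 2 = 0 :=
      le_antisymm (by nlinarith [sq_nonneg ‖(u : H)‖]) (sq_nonneg _)
    exact Subtype.ext (by simpa using h3)
  let e : 𝔸.A.domain ≃ₗ[ℝ] H := LinearEquiv.ofBijective 𝔸.A.toFun ⟨hinj, 𝔸.surjective_A⟩
  have he : ∀ u, e u = 𝔸.A u := fun _ => rfl
  let G₀ : H →ₗ[ℝ] H := 𝔸.A.domain.subtype ∘ₗ (e.symm : H →ₗ[ℝ] 𝔸.A.domain)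
  have hG₀ : ∀ y, G₀ y = ((e.symm y : 𝔸.A.domain) : H) := fun _ => rfl
  have hAG : ∀ y, 𝔸.A (e.symm y) = y := fun y => e.apply_symm_apply y
  have hquad : ∀ y, l * ‖G₀ y‖ ^ 2 ≤ ⟪y, G₀ y⟫_ℝ := by
    intro y
    have := hc (e.symm y)
    rwa [hAG] at this
  have hbd : ∀ y, ‖G₀ y‖ ≤ l⁻¹ * ‖y‖ := by
    intro y
    rw [inv_mul_eq_div, le_div_iff₀ hl]
    rcases eq_or_lt_of_le (norm_nonneg (G₀ y)) with h0 | h0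
    · rw [← h0]; simp
    · have := (hquad y).trans (real_inner_le_norm _ _)
      nlinarith
  let G : H →L[ℝ] H := G₀.mkContinuous l⁻¹ hbd
  have hG : ∀ y, G y = G₀ y := fun _ => rfl
  have hGsymm : ∀ x y, ⟪G x, y⟫_ℝ = ⟪x, G y⟫_ℝ := by
    intro x y
    have := symm_of_isSelfAdjoint 𝔸.isSelfAdjoint (e.symm x) (e.symm y)
    rw [hAG, hAG] at this
    exact this.symm
  have hGsa : IsSelfAdjoint G := by
    rw [ContinuousLinearMap.isSelfAdjoint_iff_isSymmetric]
    exact hGsymm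
  have hCsa : IsSelfAdjoint (1 - l • G) :=
    (IsSelfAdjoint.one _).sub (smul_isSelfAdjoint hGsa l)
  have hC1 : ‖1 - l • G‖ ≤ 1 := by
    refine ContinuousLinearMap.opNorm_le_bound _ zero_le_one fun x => ?_
    rw [one_mul]
    refine le_of_sq_le_sq ?_ (norm_nonneg _)
    have h1 : (1 - l • G) x = x - l • G x := rfl
    rw [h1, norm_sub_sq_real, norm_smul, inner_smul_right, Real.norm_of_nonneg hl.le]
    have h2 := hquad x
    rw [← hG] at h2
    nlinarith [sq_nonneg ‖G x‖, mul_le_mul_of_nonneg_left h2 hl.le,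
      mul_nonneg hl.le (mul_nonneg hl.le (sq_nonneg ‖G x‖))]
  obtain ⟨R₁, hR₁sa, hR₁pos, hR₁⟩ := exists_sqrt_one_sub hC1 hCsa
  set r : ℝ := (Real.sqrt l)⁻¹ with hr
  have hr0 : 0 < r := inv_pos.2 (Real.sqrt_pos.2 hl)
  have hrl : r * r * l = 1 := by
    rw [hr, ← mul_inv, Real.mul_self_sqrt hl.le, inv_mul_cancel₀ hl.ne']
  let R : H →L[ℝ] H := r • R₁
  have hRsa : IsSelfAdjoint R := smul_isSelfAdjoint hR₁sa r
  have hRpos : ∀ x, 0 ≤ ⟪R x, x⟫_ℝ := by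
    intro x
    have h1 : R x = r • R₁ x := rfl
    rw [h1, real_inner_smul_left]
    exact mul_nonneg hr0.le (hR₁pos x)
  have hRR : ∀ x, R (R x) = G x := by
    intro x
    have h1 : R (R x) = (r * r) • ((R₁ * R₁) x) := by
      change r • R₁ (r • R₁ x) = _
      rw [map_smul, smul_smul]; rfl
    rw [h1, hR₁, sub_sub_cancel]
    change (r * r) • (l • G x) = G x
    rw [smul_smul, hrl, one_smul]
  have hRinj : Function.Injective (R : H →ₗ[ℝ] H) := by
    intro x y hxy
    have h1 : G x = G y := by
      rw [← hRR, ← hRR]; exact congrArg R hxy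
    have h2 : e.symm x = e.symm y := Subtype.ext h1
    exact e.symm.injective h2
  let eR := LinearEquiv.ofInjective (R : H →ₗ[ℝ] H) hRinj
  let S : H →ₗ.[ℝ] H := ⟨LinearMap.range (R : H →ₗ[ℝ] H), (eR.symm : _ →ₗ[ℝ] H)⟩
  have hdom : ∀ u, u ∈ S.domain ↔ ∃ x, R x = u := fun u => Iff.rfl
  have hRS : ∀ u : S.domain, R (S u) = u := fun u =>
    congrArg Subtype.val (eR.apply_symm_apply u)
  have hSR : ∀ (x : H) (h : R x ∈ S.domain), S ⟨R x, h⟩ = x := fun x h => hRinj (hRS ⟨R x, h⟩)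
  refine ⟨S, inverse_isSelfAdjoint hRsa S hdom hRS hSR, fun u => ?_, fun u => ?_, ?_⟩
  · have h1 := hRpos (S u)
    rw [hRS, real_inner_comm] at h1
    exact h1
  · constructor
    · intro hu
      have h1 : u = R (R (𝔸.A ⟨u, hu⟩)) := by
        rw [hRR, hG, hG₀, ← he, e.symm_apply_apply]
      have h2 : u ∈ S.domain := (hdom u).2 ⟨_, h1.symm⟩
      refine ⟨h2, (hdom _).2 ⟨𝔸.A ⟨u, hu⟩, hRinj ?_⟩⟩
      exact h1.symm.trans (hRS ⟨u, h2⟩).symm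
    · rintro ⟨h, h'⟩
      obtain ⟨x, hx⟩ := (hdom _).1 h'
      have h1 : u = G x := by rw [← hRR, hx, hRS]
      rw [h1]
      exact (e.symm x).2
  · intro u hS hA
    have h1 : (u : H) = G (S ⟨S u, hS⟩) := by rw [← hRR, hRS, hRS]
    have h2 : (⟨u, hA⟩ : 𝔸.A.domain) = e.symm (S ⟨S u, hS⟩) := Subtype.ext h1
    rw [h2, hAG]

/-- The square root `A^{1/2}`. -/
def sqrtA : H →ₗ.[ℝ] H := 𝔸.exists_isPosSqrt.choose

theorem isPosSqrt : IsPosSqrt 𝔸.A 𝔸.sqrtA := 𝔸.exists_isPosSqrt.choose_spec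

/-- The kernel of `A^{1/2}` is trivial. -/
theorem eq_zero_of_sqrt_eq_zero (u : 𝔸.sqrtA.domain) (hu : 𝔸.sqrtA u = 0) : u = 0 := by
  obtain ⟨l, hl, hc⟩ := 𝔸.coercive
  have hS : 𝔸.sqrtA u ∈ 𝔸.sqrtA.domain := by rw [hu]; exact zero_mem _
  have hA : (u : H) ∈ 𝔸.A.domain := (𝔸.isPosSqrt.mem_domain_iff u).2 ⟨u.2, hS⟩
  have h1 : 𝔸.A ⟨u, hA⟩ = 0 := by
    rw [𝔸.isPosSqrt.apply_eq u hS hA]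
    have : (⟨𝔸.sqrtA u, hS⟩ : 𝔸.sqrtA.domain) = 0 := Subtype.ext hu
    rw [this, LinearPMap.map_zero]
  have h2 := hc ⟨u, hA⟩
  rw [h1, inner_zero_left] at h2
  have h3 : ‖(u : H)‖ ^ 2 = 0 := le_antisymm (by nlinarith [sq_nonneg ‖(u : H)‖]) (sq_nonneg _)
  exact Subtype.ext (by simpa using h3)

/-- The lower bound for `A` passes to the form: `|A^{1/2} u|² ≥ λ₁ |u|²` on `D(A^{1/2})`. -/
theorem exists_sqrt_lower_bound :
    ∃ l : ℝ, 0 < l ∧ ∀ u : 𝔸.sqrtA.domain, l * ‖(u : H)‖ ^ 2 ≤ ‖𝔸.sqrtA u‖ ^ 2 := by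
  obtain ⟨l, hl, hc⟩ := 𝔸.coercive
  refine ⟨l, hl, fun w => ?_⟩
  obtain ⟨x, hx⟩ := 𝔸.surjective_A w
  obtain ⟨hxS, hxS2⟩ := (𝔸.isPosSqrt.mem_domain_iff x).1 x.2
  have h1 : 𝔸.sqrtA ⟨𝔸.sqrtA ⟨x, hxS⟩, hxS2⟩ = w := by
    rw [← 𝔸.isPosSqrt.apply_eq ⟨x, hxS⟩ hxS2 x.2]; exact hx
  obtain ⟨hzS, hzS2⟩ : ∃ hz : 𝔸.sqrtA ⟨x, hxS⟩ ∈ 𝔸.sqrtA.domain,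
      𝔸.sqrtA ⟨𝔸.sqrtA ⟨x, hxS⟩, hz⟩ ∈ 𝔸.sqrtA.domain := ⟨hxS2, by rw [h1]; exact w.2⟩
  set z : 𝔸.sqrtA.domain := ⟨𝔸.sqrtA ⟨x, hxS⟩, hzS⟩ with hz
  have hzA : (z : H) ∈ 𝔸.A.domain := (𝔸.isPosSqrt.mem_domain_iff z).2 ⟨z.2, hzS2⟩
  have hSw : 𝔸.A ⟨z, hzA⟩ = 𝔸.sqrtA w := by
    rw [𝔸.isPosSqrt.apply_eq z hzS2 hzA]
    congr 1
    exact Subtype.ext h1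
  have h2 : ⟪𝔸.sqrtA w, (z : H)⟫_ℝ = ‖(w : H)‖ ^ 2 := by
    rw [symm_of_isSelfAdjoint 𝔸.isPosSqrt.isSelfAdjoint w z, h1, real_inner_self_eq_norm_sq]
  have h3 := hc ⟨z, hzA⟩
  rw [hSw] at h3
  have h3' : l * ‖(z : H)‖ ^ 2 ≤ ‖(w : H)‖ ^ 2 := h3.trans h2.le
  have h4 : ‖(w : H)‖ ^ 2 ≤ ‖𝔸.sqrtA w‖ * ‖(z : H)‖ := h2 ▸ real_inner_le_norm _ _
  rcases eq_or_lt_of_le (norm_nonneg (w : H)) with h0 | h0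
  · rw [← h0]; simp
  · have h5 : (‖(w : H)‖ ^ 2) ^ 2 ≤ ‖𝔸.sqrtA w‖ ^ 2 * ‖(z : H)‖ ^ 2 := by
      rw [← mul_pow]; exact pow_le_pow_left₀ (by positivity) h4 2
    have h6 : (‖(w : H)‖ ^ 2) * (l * ‖(w : H)‖ ^ 2) ≤ (‖(w : H)‖ ^ 2) * ‖𝔸.sqrtA w‖ ^ 2 := by
      nlinarith [sq_nonneg ‖𝔸.sqrtA w‖, mul_le_mul_of_nonneg_left h3' (sq_nonneg ‖𝔸.sqrtA w‖)]
    exact le_of_mul_le_mul_left h6 (by positivity)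

/-- The inner product `((u, v)) = (A^{1/2} u, A^{1/2} v)` on `D(A^{1/2})`. -/
@[reducible]
def innerCore : InnerProductSpace.Core ℝ 𝔸.sqrtA.domain where
  inner u v := ⟪𝔸.sqrtA u, 𝔸.sqrtA v⟫_ℝ
  conj_inner_symm u v := real_inner_comm _ _
  re_inner_nonneg u := real_inner_self_nonneg
  add_left u v w := by rw [LinearPMap.map_add, inner_add_left]
  smul_left u v r := by rw [LinearPMap.map_smul, real_inner_smul_left]; rfl
  definite u hu := 𝔸.eq_zero_of_sqrt_eq_zero u (inner_self_eq_zero.1 hu)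

/-- The space `V = D(A^{1/2})`, with the inner product `((u, v))` and its norm `‖u‖`. -/
def V : Type _ := 𝔸.sqrtA.domain

instance : NormedAddCommGroup 𝔸.V := 𝔸.innerCore.toNormedAddCommGroup

instance : InnerProductSpace ℝ 𝔸.V := InnerProductSpace.ofCore 𝔸.innerCore.toCore

/-- `A^{1/2}` as a linear map `V → H`. -/
def sqrtMap : 𝔸.V →ₗ[ℝ] H := 𝔸.sqrtA.toFun

/-- The inclusion `V → H`, as a linear map. -/
def inclLin : 𝔸.V →ₗ[ℝ] H := 𝔸.sqrtA.domain.subtype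

theorem inner_V_def (u v : 𝔸.V) : ⟪u, v⟫_ℝ = ⟪𝔸.sqrtMap u, 𝔸.sqrtMap v⟫_ℝ := rfl

theorem norm_V_def (u : 𝔸.V) : ‖u‖ = ‖𝔸.sqrtMap u‖ := by
  rw [← sq_eq_sq₀ (norm_nonneg _) (norm_nonneg _), ← real_inner_self_eq_norm_sq,
    ← real_inner_self_eq_norm_sq, inner_V_def]

theorem exists_norm_incl_le : ∃ C : ℝ, ∀ v : 𝔸.V, ‖𝔸.inclLin v‖ ≤ C * ‖v‖ := by
  obtain ⟨l, hl, hb⟩ := 𝔸.exists_sqrt_lower_bound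
  refine ⟨(Real.sqrt l)⁻¹, fun v => ?_⟩
  have h1 : l * ‖𝔸.inclLin v‖ ^ 2 ≤ ‖v‖ ^ 2 := by rw [norm_V_def]; exact hb v
  have h2 : Real.sqrt l * ‖𝔸.inclLin v‖ ≤ ‖v‖ := by
    refine le_of_sq_le_sq ?_ (norm_nonneg _)
    rw [mul_pow, Real.sq_sqrt hl.le]; exact h1
  rw [inv_mul_eq_div, le_div_iff₀ (Real.sqrt_pos.2 hl), mul_comm]
  exact h2

/-- The continuous embedding `V ↪ H`. -/
def incl : 𝔸.V →L[ℝ] H :=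
  LinearMap.mkContinuousOfExistsBound 𝔸.inclLin 𝔸.exists_norm_incl_le

/-- The dual space `V*` with the dual norm. -/
abbrev Vdual : Type _ := StrongDual ℝ 𝔸.V

/-- The embedding `H = H* ↪ V*`: `⟨h, v⟩ = (h, v)`. -/
def toVdual : H →L[ℝ] 𝔸.Vdual :=
  (ContinuousLinearMap.precomp ℝ 𝔸.incl).comp (innerSL ℝ : H →L[ℝ] H →L[ℝ] ℝ)

theorem toVdual_apply (h : H) (v : 𝔸.V) : 𝔸.toVdual h v = ⟪h, 𝔸.incl v⟫_ℝ := rfl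

/-- The operator `A` as a bounded operator `V → V*`: `⟨A u, v⟩ = ((u, v))`. -/
def formA : 𝔸.V →L[ℝ] 𝔸.Vdual := (innerSL ℝ : 𝔸.V →L[ℝ] 𝔸.V →L[ℝ] ℝ)

theorem formA_apply (u v : 𝔸.V) : 𝔸.formA u v = ⟪𝔸.sqrtMap u, 𝔸.sqrtMap v⟫_ℝ := rfl

/-- On `D(A)` the operator `V → V*` is the original one. -/
theorem formA_eq_of_mem_domain (u : 𝔸.V) (hu : 𝔸.incl u ∈ 𝔸.A.domain) :
    𝔸.formA u = 𝔸.toVdual (𝔸.A ⟨𝔸.incl u, hu⟩) := by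
  ext v
  obtain ⟨hS, hS2⟩ := (𝔸.isPosSqrt.mem_domain_iff _).1 hu
  rw [formA_apply, toVdual_apply, 𝔸.isPosSqrt.apply_eq ⟨𝔸.incl u, hS⟩ hS2 hu]
  exact (symm_of_isSelfAdjoint 𝔸.isPosSqrt.isSelfAdjoint ⟨_, hS2⟩ v).symm

end CoerciveOperator

/-! ### Assumptions on the coefficients -/

variable (𝔸 : CoerciveOperator H)

/-- The maps `f : H → V*` and `σ : H → H` are Lipschitz (hence measurable). -/
def LipschitzCoeff (f : H → 𝔸.Vdual) (σ : H → H) : Prop :=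
  ∃ C : ℝ, ∀ u v : H, ‖f u - f v‖ + ‖σ u - σ v‖ ≤ C * ‖u - v‖

/-- The form `b(u, v, w) = ⟨B(u, v), w⟩` of the bilinear map `B : V × V → V*` is
skew-symmetric in the last two arguments and satisfies the interpolation bound
`|b(u, v, w)| ≤ c ‖u‖^{1/2} |u|^{1/2} ‖w‖^{1/2} |w|^{1/2} ‖v‖` for some constant `c > 0`. -/
structure BilinearAssumption (B : 𝔸.V →ₗ[ℝ] 𝔸.V →ₗ[ℝ] 𝔸.Vdual) : Prop where
  skew : ∀ u v w : 𝔸.V, B u v w = -(B u w v)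
  bound : ∃ c : ℝ, 0 < c ∧ ∀ u v w : 𝔸.V,
    |B u v w| ≤ c * Real.sqrt ‖u‖ * Real.sqrt ‖𝔸.incl u‖ * Real.sqrt ‖w‖ *
      Real.sqrt ‖𝔸.incl w‖ * ‖v‖

/-! ### The path space `X_T`, the controls `K` and `S_N` -/

/-- An element of `X_T = C([0,T]; H) ∩ L²([0,T]; V)`: a function `u`, continuous from `[0,T]` to
`H`, which is almost everywhere equal to a `V`-valued function that is square integrable on `[0,T]`.
(Values outside of `[0,T]` play no role.) -/
structure XPath (T : ℝ) where
  toH : ℝ → H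
  toV : ℝ → 𝔸.V
  continuousOn_toH : ContinuousOn toH (Icc 0 T)
  memLp_toV : MemLp toV 2 (volume.restrict (Icc 0 T))
  ae_eq : ∀ᵐ t ∂(volume.restrict (Icc 0 T)), 𝔸.incl (toV t) = toH t

variable {𝔸} in
/-- The distance `|u - v|_{X_T} = (sup_{t ∈ [0,T]} |u(t) - v(t)|² + ∫₀ᵀ ‖u(s) - v(s)‖² ds)^{1/2}`. -/
def XPath.dist {T : ℝ} (u v : XPath 𝔸 T) : ℝ≥0∞ :=
  ((⨆ t ∈ Icc 0 T, ‖u.toH t - v.toH t‖ₑ ^ 2) +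
    ∫⁻ s in Icc 0 T, ‖u.toV s - v.toV s‖ₑ ^ 2) ^ (1 / 2 : ℝ)

/-- The Hilbert space `K = L²([0,T]; ℝ)`. -/
abbrev Ctrl (T : ℝ) : Type := Lp ℝ 2 (volume.restrict (Icc (0 : ℝ) T))

/-- `S_N = {k ∈ K : ∫₀ᵀ k(s)² ds ≤ N}`. -/
def ctrlBall (T N : ℝ) : Set (Ctrl T) := {k | ∫ s in Icc 0 T, (k s) ^ 2 ≤ N}

/-! ### The penalized equation -/

/-- The projection `π` onto the closed unit ball. -/
def ballProj (y : H) : H := if ‖y‖ ≤ 1 then y else ‖y‖⁻¹ • y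

/-- `∫₀ᵗ (-A u + f(u) + B(u,u) + σ(u) k) ds` in `V*`. -/
def driftIntegral (f : H → 𝔸.Vdual) (σ : H → H) (B : 𝔸.V →ₗ[ℝ] 𝔸.V →ₗ[ℝ] 𝔸.Vdual) {T : ℝ}
    (k : Ctrl T) (u : XPath 𝔸 T) (t : ℝ) : 𝔸.Vdual :=
  -(∫ s in (0 : ℝ)..t, 𝔸.formA (u.toV s)) + (∫ s in (0 : ℝ)..t, f (u.toH s))
    + (∫ s in (0 : ℝ)..t, B (u.toV s) (u.toV s))
    + ∫ s in (0 : ℝ)..t, 𝔸.toVdual (k s • σ (u.toH s))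

/-- `u` solves, on `[0,T]`, the penalized equation
`du + A u dt = f(u) dt + B(u,u) dt + σ(u) k dt - n (u - π(u)) dt`, `u(0) = u₀`. -/
structure IsPenalizedSolution (f : H → 𝔸.Vdual) (σ : H → H)
    (B : 𝔸.V →ₗ[ℝ] 𝔸.V →ₗ[ℝ] 𝔸.Vdual) (u₀ : H) {T : ℝ} (n : ℕ) (k : Ctrl T)
    (u : XPath 𝔸 T) : Prop where
  initial : u.toH 0 = u₀
  equation : ∀ t ∈ Icc 0 T, 𝔸.toVdual (u.toH t) = 𝔸.toVdual u₀ + driftIntegral 𝔸 f σ B k u t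
    - (n : ℝ) • ∫ s in (0 : ℝ)..t, 𝔸.toVdual (u.toH s - ballProj (u.toH s))

/-! ### The reflected equation -/

/-- `I` is the Riemann-Stieltjes integral `∫_a^b (g(t), L(dt))`: the limit of the sums
`∑ (g(ξ i), L(t (i+1)) - L(t i))` over tagged partitions of `[a,b]` as the mesh tends to zero. -/
def HasRSIntegral (g L : ℝ → H) (a b I : ℝ) : Prop :=
  ∀ ε > 0, ∃ δ > 0, ∀ (m : ℕ) (t ξ : ℕ → ℝ), t 0 = a → t m = b →
    (∀ i < m, t i ≤ ξ i ∧ ξ i ≤ t (i + 1) ∧ t (i + 1) - t i < δ) →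
      |∑ i ∈ Finset.range m, ⟪g (ξ i), L (t (i + 1)) - L (t i)⟫_ℝ - I| < ε

/-- `(u, L)` solves, on `[0,T]`, the reflection problem
`du + A u dt = f(u) dt + B(u,u) dt + σ(u) k dt + dL`, `u(0) = u₀`, in the closed unit ball. -/
structure IsReflectedSolution (f : H → 𝔸.Vdual) (σ : H → H)
    (B : 𝔸.V →ₗ[ℝ] 𝔸.V →ₗ[ℝ] 𝔸.Vdual) (u₀ : H) {T : ℝ} (k : Ctrl T)
    (u : XPath 𝔸 T) (L : ℝ → H) : Prop where
  mem_ball : ∀ t ∈ Icc 0 T, ‖u.toH t‖ ≤ 1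
  initial : u.toH 0 = u₀
  continuousOn_L : ContinuousOn L (Icc 0 T)
  boundedVariation_L : BoundedVariationOn L (Icc 0 T)
  initial_L : L 0 = 0
  equation : ∀ t ∈ Icc 0 T,
    𝔸.toVdual (u.toH t) = 𝔸.toVdual u₀ + driftIntegral 𝔸 f σ B k u t + 𝔸.toVdual (L t)
  reflection : ∀ φ : ℝ → H, ContinuousOn φ (Icc 0 T) → (∀ t ∈ Icc 0 T, ‖φ t‖ ≤ 1) →
    ∃ I : ℝ, HasRSIntegral (fun t => φ t - u.toH t) L 0 T I ∧ 0 ≤ I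

end ReflectedSEE

end

/-! The proof gives a rate: uniformly over the controls in `ctrlBall T N`, the squared error is at
most a constant over the square root of `n`. Write u for a penalized solution, (v, L) for a
reflected one, and w = u - v.

Energy equality (`tendsto_energy`). If w is continuous in H, square integrable in V, and w = w(0) +
∫ g + L in V* with g in L²(V*), then |w(t)|² - |w(0)|² = 2 ∫ ⟨g, w⟩ + 2 ∫ (w, dL). To avoid
differentiating w or building a Stieltjes calculus, pair the increment of the equation over [s, s+h]
with w(s) + w(s+h), integrate in s and divide by h. The left side telescopes to boundary averages,
and the g term converges because translations are continuous in L². Hence the averaged sums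
`averagedStieltjes` of L converge, and their limit plays the role of 2 ∫ (w, dL). For h = t/(m+1)
such an average is a mean of left- plus right-tagged Riemann-Stieltjes sums over shifted grids, so
the sign in the reflection condition passes to the limit.

Penalized solutions nearly stay in the ball (`exists_penalized_bound`). The penalization feeds -n
(|u|² - 1)⁺ into the energy, while B drops out. Grönwall bounds |u| uniformly in `n` and `k`. Then
|u|² - 1 has a restoring drift of strength n against a forcing of size 1 + |k|. Splitting |k| ≤ √n/2
+ k²/(2√n) yields |u|² ≤ 1 + ε with ε = O(n^{-1/2}).

Reflected solutions (`exists_reflected_bound`). Testing with φ = 0 gives ∫ (v, dL) ≤ 0, hence a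
bound for v in L²(V); the energy equality also bounds -∫ (v, dL).

Comparison (`energy_diff_le`, `exists_error_bound`). The path u/(1+ε) lies in the ball and is an
admissible φ; it gives -∫ (w, dL) ≤ -ε ∫ (v, dL) = O(ε). The penalization pairs with u - v with a
favourable sign because v is in the ball, and B(u,u) - B(v,v) paired with w reduces to ⟨B(w,v), w⟩,
which is controlled by ‖w‖ |w| ‖v‖. Grönwall with the coefficient const + ‖v‖² + |k|, up to
constants, whose integral is bounded uniformly in `k`, finishes the proof. -/

noncomputable section

namespace ReflectedSEE

section

/-! ### Continuity of translations in `L²` and the averaged duality pairing -/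

/-- Translations are continuous in `L²(ℝ; E)`. -/
theorem tendsto_eLpNorm_translate_sub {E : Type*} [NormedAddCommGroup E] {F : ℝ → E}
    (hF : MemLp F 2 volume) :
    Tendsto (fun h : ℝ => eLpNorm (fun s => F (s + h) - F s) 2 volume) (𝓝 0) (𝓝 0) := by
  -- The shifts form a continuous curve in the compact-open topology, and composition of an L²
  -- function with measure preserving maps is continuous along such a curve.
  let g : ℝ → C(ℝ, ℝ) := fun h => ⟨fun s => s + h, by fun_prop⟩
  have hg : Continuous g := by
    have : Continuous fun p : ℝ × ℝ => p.2 + p.1 := by fun_prop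
    exact (ContinuousMap.curry ⟨_, this⟩).continuous
  have hgm : ∀ h, MeasurePreserving (g h) volume volume := fun h =>
    measurePreserving_add_right volume h
  have h1 := (Continuous.compMeasurePreservingLp (continuous_const (y := hF.toLp F)) hg hgm
    (by norm_num)).tendsto 0
  have h2 : Lp.compMeasurePreserving (g 0) (hgm 0) (hF.toLp F) = hF.toLp F := by
    rw [Lp.toLp_compMeasurePreserving]
    congr 1
    ext s
    simp [g]
  rw [h2, tendsto_iff_edist_tendsto_0] at h1
  refine h1.congr fun h => ?_
  rw [Lp.toLp_compMeasurePreserving, Lp.edist_toLp_toLp]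
  rfl

theorem eLpNorm_translate {E : Type*} [NormedAddCommGroup E] {F : ℝ → E}
    (hF : MemLp F 2 volume) (h : ℝ) :
    eLpNorm (fun s => F (s + h)) 2 volume = eLpNorm F 2 volume :=
  eLpNorm_comp_measurePreserving hF.1 (measurePreserving_add_right volume h)

theorem memLp_translate {E : Type*} [NormedAddCommGroup E] {F : ℝ → E}
    (hF : MemLp F 2 volume) (h : ℝ) : MemLp (fun s => F (s + h)) 2 volume :=
  hF.comp_measurePreserving (measurePreserving_add_right volume h)

variable {E : Type*} [NormedAddCommGroup E] [NormedSpace ℝ E]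

theorem aestronglyMeasurable_dual_apply {α : Type*} [MeasurableSpace α] {μ : Measure α}
    {G : α → StrongDual ℝ E} {X : α → E} (hG : AEStronglyMeasurable G μ)
    (hX : AEStronglyMeasurable X μ) : AEStronglyMeasurable (fun a => G a (X a)) μ :=
  (isBoundedBilinearMap_apply (𝕜 := ℝ) (E := E) (F := ℝ)).continuous.comp_aestronglyMeasurable
    (hG.prodMk hX)

/-- The duality pairing of two `L²` functions is integrable, with the Cauchy-Schwarz bound. -/
theorem lintegral_dual_apply_le {α : Type*} [MeasurableSpace α] {μ : Measure α}
    {G : α → StrongDual ℝ E} {X : α → E}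
    (hG : AEStronglyMeasurable G μ) (hX : AEStronglyMeasurable X μ) :
    ∫⁻ a, ‖G a (X a)‖ₑ ∂μ ≤ eLpNorm G 2 μ * eLpNorm X 2 μ := by
  have h := eLpNorm_le_eLpNorm_mul_eLpNorm_of_nnnorm (p := 2) (q := 2) (r := 1) hG hX
    (fun (T : StrongDual ℝ E) x => T x) 1
    (Eventually.of_forall fun a => by simpa using (G a).le_opNNNorm (X a))
  simpa [eLpNorm_one_eq_lintegral_enorm] using h

theorem integrable_dual_apply {α : Type*} [MeasurableSpace α] {μ : Measure α}
    {G : α → StrongDual ℝ E} {X : α → E} (hG : MemLp G 2 μ) (hX : MemLp X 2 μ) :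
    Integrable (fun a => G a (X a)) μ :=
  ⟨aestronglyMeasurable_dual_apply hG.1 hX.1, (lintegral_dual_apply_le hG.1 hX.1).trans_lt
    (ENNReal.mul_lt_top hG.2 hX.2)⟩

/-- `∫ |⟨G(s+r), X(s) + X(s+h)⟩ - 2 ⟨G(s), X(s)⟩| ds` is small, uniformly in `0 ≤ r ≤ h`. -/
theorem exists_lintegral_translate_pairing_lt {G : ℝ → StrongDual ℝ E} {X : ℝ → E}
    (hG : MemLp G 2 volume) (hX : MemLp X 2 volume) {ε : ℝ≥0∞} (hε : 0 < ε) :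
    ∃ δ > 0, ∀ h ∈ Ioo 0 δ, ∀ r ∈ Icc 0 h,
      ∫⁻ s, ‖G (s + r) (X s + X (s + h)) - 2 * G s (X s)‖ₑ ≤ ε := by
  -- The two terms bound the pieces of the splitting G(s+r)(X(s)+X(s+h)) - 2 G(s)X(s) = (G(s+r) -
  -- G(s))(X(s)+X(s+h)) + G(s)(X(s+h) - X(s)).
  have hcont : Tendsto (fun p : ℝ × ℝ =>
      eLpNorm (fun s => G (s + p.1) - G s) 2 volume * (eLpNorm X 2 volume + eLpNorm X 2 volume)
      + eLpNorm G 2 volume * eLpNorm (fun s => X (s + p.2) - X s) 2 volume)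
      (𝓝 (0, 0)) (𝓝 0) := by
    have h1 := (tendsto_eLpNorm_translate_sub hG).comp
      (continuous_fst.tendsto ((0 : ℝ), (0 : ℝ)))
    have h2 := (tendsto_eLpNorm_translate_sub hX).comp
      (continuous_snd.tendsto ((0 : ℝ), (0 : ℝ)))
    have h3 := ENNReal.Tendsto.mul_const (b := eLpNorm X 2 volume + eLpNorm X 2 volume) h1
      (Or.inr (ENNReal.add_lt_top.2 ⟨hX.2, hX.2⟩).ne)
    have h4 := ENNReal.Tendsto.const_mul (a := eLpNorm G 2 volume) h2 (Or.inr hG.2.ne)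
    simpa using h3.add h4
  have h1 := hcont.eventually (Iio_mem_nhds hε)
  rw [Metric.eventually_nhds_iff] at h1
  obtain ⟨δ, hδ, h1⟩ := h1
  refine ⟨δ, hδ, fun h hh r hr => ?_⟩
  have h2 := h1 (y := (r, h)) (by
    rw [Prod.dist_eq, max_lt_iff]
    simp only [Real.dist_eq, sub_zero]
    rw [abs_of_nonneg hr.1, abs_of_pos hh.1]
    exact ⟨hr.2.trans_lt hh.2, hh.2⟩)
  refine le_trans ?_ (le_of_lt h2)
  have m1 : MemLp (fun s => G (s + r) - G s) 2 volume := (memLp_translate hG r).sub hG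
  have m2 : MemLp (fun s => X (s + h) - X s) 2 volume := (memLp_translate hX h).sub hX
  have m3 : MemLp (fun s => X s + X (s + h)) 2 volume := hX.add (memLp_translate hX h)
  calc ∫⁻ s, ‖G (s + r) (X s + X (s + h)) - 2 * G s (X s)‖ₑ
      ≤ ∫⁻ s, (‖(G (s + r) - G s) (X s + X (s + h))‖ₑ + ‖G s (X (s + h) - X s)‖ₑ) := by
        refine lintegral_mono fun s => ?_
        refine le_trans (le_of_eq ?_) (enorm_add_le _ _)
        congr 1
        simp only [map_add, map_sub, sub_apply]
        ring
    _ = (∫⁻ s, ‖(G (s + r) - G s) (X s + X (s + h))‖ₑ) + ∫⁻ s, ‖G s (X (s + h) - X s)‖ₑ :=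
        lintegral_add_left' (aestronglyMeasurable_dual_apply m1.1 m3.1).enorm _
    _ ≤ _ := by
        refine add_le_add ((lintegral_dual_apply_le m1.1 m3.1).trans ?_)
          (lintegral_dual_apply_le hG.1 m2.1)
        refine mul_le_mul_right ?_ _
        refine (eLpNorm_add_le hX.1 (memLp_translate hX h).1 (by norm_num)).trans ?_
        rw [eLpNorm_translate hX]

/-- Joint integrability needed to exchange the order of integration. -/
theorem integrable_prod_translate_pairing {G : ℝ → StrongDual ℝ E} {Y : ℝ → E}
    (hG : MemLp G 2 volume) (hGm : StronglyMeasurable G)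
    (hY : MemLp Y 2 volume) (hYm : StronglyMeasurable Y) {S R : Set ℝ}
    (hR : volume R ≠ ∞) :
    Integrable (fun p : ℝ × ℝ => G (p.1 + p.2) (Y p.1))
      ((volume.restrict S).prod (volume.restrict R)) := by
  have hm : StronglyMeasurable (fun p : ℝ × ℝ => G (p.1 + p.2) (Y p.1)) :=
    (isBoundedBilinearMap_apply (𝕜 := ℝ) (E := E) (F := ℝ)).continuous.comp_stronglyMeasurable
      ((hGm.comp_measurable (measurable_fst.add measurable_snd)).prodMk
        (hYm.comp_measurable measurable_fst))
  have : IsFiniteMeasure (volume.restrict R) := ⟨by simpa using hR.lt_top⟩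
  refine ⟨hm.aestronglyMeasurable, ?_⟩
  rw [hasFiniteIntegral_iff_enorm, lintegral_prod_symm' _ hm.enorm]
  calc ∫⁻ r, ∫⁻ s, ‖G (s + r) (Y s)‖ₑ ∂volume.restrict S ∂volume.restrict R
      ≤ ∫⁻ _, eLpNorm G 2 volume * eLpNorm Y 2 volume ∂volume.restrict R := by
        refine lintegral_mono fun r => ?_
        refine (lintegral_mono' Measure.restrict_le_self le_rfl).trans ?_
        refine (lintegral_dual_apply_le (memLp_translate hG r).1 hY.1).trans ?_
        rw [eLpNorm_translate hG]
    _ < ∞ := by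
        rw [lintegral_const]
        exact ENNReal.mul_lt_top (ENNReal.mul_lt_top hG.2 hY.2) (measure_lt_top _ _)

/-- Convergence of the averaged pairing. -/
theorem tendsto_average_pairing {G : ℝ → StrongDual ℝ E} {X : ℝ → E} {t : ℝ} (ht : 0 < t)
    (hG : MemLp G 2 volume) (hGm : StronglyMeasurable G)
    (hX : MemLp X 2 volume) (hXm : StronglyMeasurable X) :
    Tendsto (fun h : ℝ => h⁻¹ * ∫ s in (0 : ℝ)..(t - h),
        (∫ r in s..(s + h), G r) (X s + X (s + h))) (𝓝[>] 0)
      (𝓝 (2 * ∫ s in (0 : ℝ)..t, G s (X s))) := by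
  have hGX := integrable_dual_apply hG hX
  have hGli : LocallyIntegrable G volume := hG.locallyIntegrable (by norm_num)
  have hGi : ∀ a b : ℝ, IntervalIntegrable G volume a b := fun a b =>
    (hGli.integrableOn_isCompact isCompact_uIcc).intervalIntegrable
  rw [Metric.tendsto_nhdsWithin_nhds]
  intro ε hε
  obtain ⟨δ₁, hδ₁, h1⟩ := exists_lintegral_translate_pairing_lt hG hX
    (ε := ENNReal.ofReal (ε / 4)) (by simpa using hε)
  -- Continuity of the primitive absorbs the missing piece [t-h, t]. It enters with a factor 2, so
  -- ε/8 here and ε/4 from the translations leave ε/2.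
  have hprim : Continuous fun x => ∫ s in (0 : ℝ)..x, G s (X s) :=
    intervalIntegral.continuous_primitive (fun a b => hGX.intervalIntegrable) 0
  obtain ⟨δ₂, hδ₂, h2⟩ := Metric.continuousAt_iff.1 (hprim.continuousAt (x := t)) (ε / 8)
    (by positivity)
  refine ⟨min (min δ₁ δ₂) t, by positivity, fun h hh0 hh => ?_⟩
  rw [mem_Ioi] at hh0
  rw [Real.dist_eq, sub_zero, abs_of_pos hh0, lt_min_iff, lt_min_iff] at hh
  obtain ⟨⟨hh1, hh2⟩, hht⟩ := hh
  have hY : MemLp (fun s => X s + X (s + h)) 2 volume := hX.add (memLp_translate hX h)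
  have hYm : StronglyMeasurable (fun s => X s + X (s + h)) :=
    hXm.add (hXm.comp_measurable (measurable_id.add_const h))
  have hprod := integrable_prod_translate_pairing hG hGm hY hYm (S := Ioc 0 (t - h))
    (R := Ioc 0 h) (by simp)
  have hΦi : IntervalIntegrable (fun r => ∫ s in (0 : ℝ)..(t - h),
      G (s + r) (X s + X (s + h))) volume 0 h := by
    rw [intervalIntegrable_iff_integrableOn_Ioc_of_le hh0.le]
    simp_rw [intervalIntegral.integral_of_le (sub_nonneg.2 hht.le)]
    exact hprod.integral_prod_right
  -- Fubini: for each fixed shift r in [0, h] the integral over s is already close to the limit, so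
  -- its mean over r is too.
  have hswap : ∫ s in (0 : ℝ)..(t - h), (∫ r in s..(s + h), G r) (X s + X (s + h)) =
      ∫ r in (0 : ℝ)..h, ∫ s in (0 : ℝ)..(t - h), G (s + r) (X s + X (s + h)) := by
    have e1 : ∀ s, (∫ r in s..(s + h), G r) (X s + X (s + h)) =
        ∫ r in (0 : ℝ)..h, G (s + r) (X s + X (s + h)) := by
      intro s
      have : ∫ r in s..(s + h), G r = ∫ r in (0 : ℝ)..h, G (s + r) := by
        rw [intervalIntegral.integral_comp_add_left, add_zero]
      rw [this, ContinuousLinearMap.intervalIntegral_apply]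
      have := (hGi (s + 0) (s + h)).comp_add_left s
      simpa using this
    simp_rw [e1, intervalIntegral.integral_of_le (sub_nonneg.2 hht.le),
      intervalIntegral.integral_of_le hh0.le]
    exact integral_integral_swap hprod
  rw [hswap, Real.dist_eq]
  have hc : 2 * ∫ s in (0 : ℝ)..t, G s (X s) =
      h⁻¹ * ∫ _ in (0 : ℝ)..h, 2 * ∫ s in (0 : ℝ)..t, G s (X s) := by
    rw [intervalIntegral.integral_const, sub_zero, smul_eq_mul, inv_mul_cancel_left₀ hh0.ne']
  rw [hc, ← mul_sub, ← intervalIntegral.integral_sub hΦi (by simp), abs_mul,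
    abs_of_pos (inv_pos.2 hh0)]
  have hb : ∀ r ∈ uIoc (0 : ℝ) h, ‖(∫ s in (0 : ℝ)..(t - h), G (s + r) (X s + X (s + h))) -
      2 * ∫ s in (0 : ℝ)..t, G s (X s)‖ ≤ ε / 2 := by
    intro r hr
    rw [uIoc_of_le hh0.le] at hr
    have i1 : Integrable (fun s => G (s + r) (X s + X (s + h))) volume :=
      integrable_dual_apply (memLp_translate hG r) hY
    have i2 : Integrable (fun s => 2 * G s (X s)) volume := hGX.const_mul 2
    have e1 : (∫ s in (0 : ℝ)..(t - h), G (s + r) (X s + X (s + h))) -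
        2 * ∫ s in (0 : ℝ)..t, G s (X s) =
        (∫ s in (0 : ℝ)..(t - h), (G (s + r) (X s + X (s + h)) - 2 * G s (X s))) +
        2 * ((∫ s in (0 : ℝ)..(t - h), G s (X s)) - ∫ s in (0 : ℝ)..t, G s (X s)) := by
      rw [intervalIntegral.integral_sub i1.intervalIntegrable i2.intervalIntegrable,
        intervalIntegral.integral_const_mul]
      ring
    have b1 : ‖∫ s in (0 : ℝ)..(t - h), (G (s + r) (X s + X (s + h)) - 2 * G s (X s))‖
        ≤ ε / 4 := by
      refine intervalIntegral.norm_integral_le_integral_norm_uIoc.trans ?_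
      have i3 : Integrable (fun s => G (s + r) (X s + X (s + h)) - 2 * G s (X s)) volume :=
        i1.sub i2
      rw [integral_norm_eq_lintegral_enorm i3.1.restrict]
      refine ENNReal.toReal_le_of_le_ofReal (by positivity) ?_
      exact (lintegral_mono' Measure.restrict_le_self le_rfl).trans
        (h1 h ⟨hh0, hh1⟩ r ⟨hr.1.le, hr.2⟩)
    have b2 := h2 (x := t - h) (by
      rw [Real.dist_eq, sub_sub_cancel_left, abs_neg, abs_of_pos hh0]; exact hh2)
    rw [Real.dist_eq] at b2
    rw [e1]
    refine (norm_add_le _ _).trans ?_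
    rw [norm_mul, Real.norm_eq_abs 2, abs_two, Real.norm_eq_abs (_ - _)]
    linarith
  have := intervalIntegral.norm_integral_le_of_norm_le_const hb
  rw [sub_zero, abs_of_pos hh0, Real.norm_eq_abs] at this
  calc h⁻¹ * _ ≤ h⁻¹ * (ε / 2 * h) := mul_le_mul_of_nonneg_left this (inv_pos.2 hh0).le
    _ = ε / 2 := by field_simp
    _ < ε := by linarith

end

section

variable {H : Type*} [NormedAddCommGroup H] [InnerProductSpace ℝ H]

/-! ### The energy equality -/

/-- The averaged Riemann-Stieltjes sums
`h⁻¹ ∫₀^{t-h} (L(s+h) - L(s), x(s) + x(s+h)) ds`, which approximate `2 ∫₀ᵗ (x, dL)`. -/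
def averagedStieltjes (L x : ℝ → H) (t h : ℝ) : ℝ :=
  h⁻¹ * ∫ s in (0 : ℝ)..(t - h), ⟪L (s + h) - L s, x s + x (s + h)⟫_ℝ

theorem inner_incr_eq (a b : H) : ⟪b - a, a + b⟫_ℝ = ‖b‖ ^ 2 - ‖a‖ ^ 2 := by
  rw [inner_sub_left, inner_add_right, inner_add_right, real_inner_self_eq_norm_sq,
    real_inner_self_eq_norm_sq, real_inner_comm a b]
  ring

/-- After the shift of variable most of the two integrals cancels; what remains is a backward
difference quotient at t minus a forward one at 0 of a primitive of `ψ`. -/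
theorem tendsto_boundary_average {ψ : ℝ → ℝ} (hψ : Continuous ψ) (t : ℝ) :
    Tendsto (fun h : ℝ => h⁻¹ * ((∫ s in (0 : ℝ)..(t - h), ψ (s + h)) -
      ∫ s in (0 : ℝ)..(t - h), ψ s)) (𝓝[>] 0) (𝓝 (ψ t - ψ 0)) := by
  let Ψ : ℝ → ℝ := fun x => ∫ s in (0 : ℝ)..x, ψ s
  have hd : ∀ x, HasDerivAt Ψ (ψ x) x := fun x =>
    intervalIntegral.integral_hasDerivAt_right (hψ.intervalIntegrable _ _)
      (hψ.stronglyMeasurableAtFilter _ _) hψ.continuousAt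
  have hpos : Tendsto (fun h : ℝ => h) (𝓝[>] 0) (𝓝[≠] 0) :=
    tendsto_id.mono_right (nhdsWithin_mono _ fun x hx => ne_of_gt hx)
  have hneg : Tendsto (fun h : ℝ => -h) (𝓝[>] 0) (𝓝[≠] 0) := by
    refine tendsto_nhdsWithin_iff.2 ⟨?_, ?_⟩
    · have := (continuous_neg.tendsto (0 : ℝ)).mono_left (nhdsWithin_le_nhds (s := Ioi 0))
      simpa using this
    · filter_upwards [self_mem_nhdsWithin] with h hh
      exact neg_ne_zero.2 (ne_of_gt hh)
  have h1 := (hasDerivAt_iff_tendsto_slope_zero.1 (hd t)).comp hneg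
  have h2 := (hasDerivAt_iff_tendsto_slope_zero.1 (hd 0)).comp hpos
  refine (h1.sub h2).congr fun h => ?_
  have e1 : ∫ s in (0 : ℝ)..(t - h), ψ (s + h) = Ψ t - Ψ h := by
    rw [intervalIntegral.integral_comp_add_right, zero_add, sub_add_cancel]
    exact (intervalIntegral.integral_interval_sub_left (hψ.intervalIntegrable _ _)
      (hψ.intervalIntegrable _ _)).symm
  have e2 : Ψ 0 = 0 := intervalIntegral.integral_same
  have e3 : ∫ s in (0 : ℝ)..(t - h), ψ s = Ψ (t + -h) := by rw [← sub_eq_add_neg]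
  rw [e1, e3]
  simp only [Function.comp_apply, smul_eq_mul, zero_add, e2, inv_neg]
  ring

/-- Extension by zero of a strongly measurable representative: translations need a function on all
of ℝ, and Fubini needs (s, r) ↦ G(s+r) to be jointly measurable. -/
theorem exists_extension_of_memLp_restrict {E : Type*} [NormedAddCommGroup E] {F : ℝ → E}
    {S : Set ℝ} (hS : MeasurableSet S) (hF : MemLp F 2 (volume.restrict S)) :
    ∃ F' : ℝ → E, StronglyMeasurable F' ∧ MemLp F' 2 volume ∧ ∀ᵐ s, s ∈ S → F' s = F s := by
  refine ⟨S.indicator (hF.1.mk F), hF.1.stronglyMeasurable_mk.indicator hS,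
    (memLp_indicator_iff_restrict hS).2 ((memLp_congr_ae hF.1.ae_eq_mk).1 hF), ?_⟩
  filter_upwards [(ae_restrict_iff' hS).1 hF.1.ae_eq_mk] with s h1 hs
  rw [indicator_of_mem hs, h1 hs]

variable [CompleteSpace H] (𝔸 : CoerciveOperator H)

/-- The identity |b|² - |a|² = (b - a, a + b), applied to the increments of w over [s, s+h], splits
the boundary averages into the averaged pairing with G and the averaged sums of L. The first two
converge, hence so does the third. Only continuity of L is needed, not bounded variation. -/
theorem tendsto_energy_of_continuous {t : ℝ} (ht : 0 < t) {w L : ℝ → H} (hw : Continuous w)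
    (hL : Continuous L) {G : ℝ → 𝔸.Vdual} {X : ℝ → 𝔸.V}
    (hG : MemLp G 2 volume) (hGm : StronglyMeasurable G)
    (hX : MemLp X 2 volume) (hXm : StronglyMeasurable X)
    (hXw : ∀ᵐ s, s ∈ Icc 0 t → 𝔸.incl (X s) = w s)
    (heq : ∀ s ∈ Icc 0 t, 𝔸.toVdual (w s) =
      𝔸.toVdual (w 0) + (∫ r in (0 : ℝ)..s, G r) + 𝔸.toVdual (L s)) :
    Tendsto (averagedStieltjes L w t) (𝓝[>] 0)
      (𝓝 (‖w t‖ ^ 2 - ‖w 0‖ ^ 2 - 2 * ∫ s in (0 : ℝ)..t, G s (X s))) := by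
  have hψ : Continuous fun s => ‖w s‖ ^ 2 := by fun_prop
  have hGli : LocallyIntegrable G volume := hG.locallyIntegrable (by norm_num)
  have hGi : ∀ a b : ℝ, IntervalIntegrable G volume a b := fun a b =>
    (hGli.integrableOn_isCompact isCompact_uIcc).intervalIntegrable
  refine ((tendsto_boundary_average hψ t).sub
    (tendsto_average_pairing ht hG hGm hX hXm)).congr' ?_
  filter_upwards [Ioo_mem_nhdsGT ht] with h hh
  have hXw' : ∀ᵐ s, s + h ∈ Icc 0 t → 𝔸.incl (X (s + h)) = w (s + h) :=
    (measurePreserving_add_right volume h).quasiMeasurePreserving.ae hXw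
  -- The increment of the equation is tested against X(s) + X(s+h), whose image in H is w(s) +
  -- w(s+h) for almost every s.
  have key : ∫ s in (0 : ℝ)..(t - h), (∫ r in s..(s + h), G r) (X s + X (s + h)) =
      ∫ s in (0 : ℝ)..(t - h), ((‖w (s + h)‖ ^ 2 - ‖w s‖ ^ 2) -
        ⟪L (s + h) - L s, w s + w (s + h)⟫_ℝ) := by
    refine intervalIntegral.integral_congr_ae ?_
    filter_upwards [hXw, hXw'] with s h1 h2 hs
    rw [uIoc_of_le (by linarith [hh.2])] at hs
    have m1 : s ∈ Icc 0 t := ⟨hs.1.le, by linarith [hs.2, hh.1]⟩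
    have m2 : s + h ∈ Icc 0 t := ⟨by linarith [hs.1, hh.1], by linarith [hs.2]⟩
    have e : (∫ r in s..(s + h), G r) =
        𝔸.toVdual (w (s + h) - w s) - 𝔸.toVdual (L (s + h) - L s) := by
      rw [← intervalIntegral.integral_interval_sub_left (hGi 0 (s + h)) (hGi 0 s),
        map_sub, map_sub, heq _ m1, heq _ m2]
      abel
    rw [e, sub_apply, CoerciveOperator.toVdual_apply, CoerciveOperator.toVdual_apply,
      map_add, h1 m1, h2 m2, inner_incr_eq]
  rw [key, averagedStieltjes, intervalIntegral.integral_sub, intervalIntegral.integral_sub]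
  · ring
  all_goals
    refine Continuous.intervalIntegrable ?_ _ _
    fun_prop

/-- The energy equality: if `w` is continuous in `H`, square integrable in `V`, and
`w = w(0) + ∫ g + L` in `V*`, then `2 ∫₀ᵗ (w, dL) = |w(t)|² - |w(0)|² - 2 ∫₀ᵗ ⟨g, w⟩`. -/
theorem tendsto_energy {t : ℝ} (ht : 0 < t) {w L : ℝ → H} (hw : ContinuousOn w (Icc 0 t))
    (hL : ContinuousOn L (Icc 0 t)) {g : ℝ → 𝔸.Vdual} {W : ℝ → 𝔸.V}
    (hg : MemLp g 2 (volume.restrict (Icc 0 t))) (hW : MemLp W 2 (volume.restrict (Icc 0 t)))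
    (hWw : ∀ᵐ s ∂(volume.restrict (Icc 0 t)), 𝔸.incl (W s) = w s)
    (heq : ∀ s ∈ Icc 0 t, 𝔸.toVdual (w s) =
      𝔸.toVdual (w 0) + (∫ r in (0 : ℝ)..s, g r) + 𝔸.toVdual (L s)) :
    Tendsto (averagedStieltjes L w t) (𝓝[>] 0)
      (𝓝 (‖w t‖ ^ 2 - ‖w 0‖ ^ 2 - 2 * ∫ s in (0 : ℝ)..t, g s (W s))) := by
  -- Precomposing with the projection onto [0, t] extends w and L continuously to ℝ; for 0 < h < t
  -- the averages only see times in [0, t].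
  let c : ℝ → ℝ := fun s => projIcc 0 t ht.le s
  have hcc : Continuous c := continuous_projIcc.subtype_val
  have hcm : ∀ s, c s ∈ Icc 0 t := fun s => (projIcc 0 t ht.le s).2
  have hce : ∀ s ∈ Icc 0 t, c s = s := fun s hs => by simp only [c, projIcc_of_mem ht.le hs]
  have m0 : (0 : ℝ) ∈ Icc 0 t := ⟨le_rfl, ht.le⟩
  have mt : t ∈ Icc 0 t := ⟨ht.le, le_rfl⟩
  obtain ⟨G, hGm, hGL, hGg⟩ := exists_extension_of_memLp_restrict measurableSet_Icc hg
  obtain ⟨X, hXm, hXL, hXW⟩ := exists_extension_of_memLp_restrict measurableSet_Icc hW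
  have hGi : ∀ s ∈ Icc 0 t, ∫ r in (0 : ℝ)..s, G r = ∫ r in (0 : ℝ)..s, g r := by
    intro s hs
    refine intervalIntegral.integral_congr_ae ?_
    filter_upwards [hGg] with r h1 hr
    rw [uIoc_of_le hs.1] at hr
    exact h1 ⟨hr.1.le, hr.2.trans hs.2⟩
  have key := tendsto_energy_of_continuous 𝔸 ht (hw.comp_continuous hcc hcm)
    (hL.comp_continuous hcc hcm) hGL hGm hXL hXm
    (by
      filter_upwards [hXW, (ae_restrict_iff' measurableSet_Icc).1 hWw] with s h1 h2 hs
      rw [h1 hs, h2 hs, Function.comp_apply, hce s hs])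
    (by
      intro s hs
      simp only [Function.comp_apply]
      rw [hce s hs, hce 0 m0, hGi s hs, heq s hs])
  simp only [Function.comp_apply] at key
  rw [hce t mt, hce 0 m0] at key
  have e1 : ∫ s in (0 : ℝ)..t, G s (X s) = ∫ s in (0 : ℝ)..t, g s (W s) := by
    refine intervalIntegral.integral_congr_ae ?_
    filter_upwards [hGg, hXW] with r h1 h2 hr
    rw [uIoc_of_le ht.le] at hr
    rw [h1 (Ioc_subset_Icc_self hr), h2 (Ioc_subset_Icc_self hr)]
  rw [e1] at key
  refine key.congr' ?_
  filter_upwards [Ioo_mem_nhdsGT ht] with h hh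
  rw [averagedStieltjes, averagedStieltjes]
  congr 1
  refine intervalIntegral.integral_congr fun s hs => ?_
  rw [uIcc_of_le (by linarith [hh.2])] at hs
  have m1 : s ∈ Icc 0 t := ⟨hs.1, by linarith [hs.2, hh.1]⟩
  have m2 : s + h ∈ Icc 0 t := ⟨by linarith [hs.1, hh.1], by linarith [hs.2]⟩
  simp only [Function.comp_apply, hce _ m1, hce _ m2]

end

section

variable {H : Type*} [NormedAddCommGroup H] [InnerProductSpace ℝ H]

/-! ### Riemann-Stieltjes sums -/

/-- `τ`, with tags `ξ`, is a tagged partition of `[a,b]` into `m` intervals, of mesh below `δ`. -/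
structure IsTaggedPartition (a b δ : ℝ) (m : ℕ) (τ ξ : ℕ → ℝ) : Prop where
  left : τ 0 = a
  right : τ m = b
  tag : ∀ i < m, τ i ≤ ξ i ∧ ξ i ≤ τ (i + 1) ∧ τ (i + 1) - τ i < δ

/-- The Riemann-Stieltjes sum of a tagged partition. -/
def stieltjesSum (g L : ℝ → H) (m : ℕ) (τ ξ : ℕ → ℝ) : ℝ :=
  ∑ i ∈ Finset.range m, ⟪g (ξ i), L (τ (i + 1)) - L (τ i)⟫_ℝ

theorem IsTaggedPartition.le {a b δ : ℝ} {m : ℕ} {τ ξ : ℕ → ℝ}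
    (h : IsTaggedPartition a b δ m τ ξ) {i j : ℕ} (hij : i ≤ j) (hj : j ≤ m) : τ i ≤ τ j := by
  induction j, hij using Nat.le_induction with
  | base => exact le_rfl
  | succ j _ ih =>
    have := h.tag j hj
    exact (ih (by omega)).trans (this.1.trans this.2.1)

theorem IsTaggedPartition.mem {a b δ : ℝ} {m : ℕ} {τ ξ : ℕ → ℝ}
    (h : IsTaggedPartition a b δ m τ ξ) {i : ℕ} (hi : i ≤ m) : τ i ∈ Icc a b := by
  have h1 := h.le (Nat.zero_le i) hi
  have h2 := h.le hi le_rfl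
  rw [h.left] at h1
  rw [h.right] at h2
  exact ⟨h1, h2⟩

theorem IsTaggedPartition.tag_mem {a b δ : ℝ} {m : ℕ} {τ ξ : ℕ → ℝ}
    (h : IsTaggedPartition a b δ m τ ξ) {i : ℕ} (hi : i < m) : ξ i ∈ Icc a b :=
  ⟨(h.mem hi.le).1.trans (h.tag i hi).1, (h.tag i hi).2.1.trans (h.mem hi).2⟩

theorem exists_isTaggedPartition {a b δ : ℝ} (hab : a ≤ b) (hδ : 0 < δ) :
    ∃ m τ ξ, IsTaggedPartition a b δ m τ ξ := by
  obtain ⟨m, hm⟩ := exists_nat_gt ((b - a) / δ)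
  have hm0 : (0 : ℝ) < m := (div_nonneg (sub_nonneg.2 hab) hδ.le).trans_lt hm
  have hstep : ∀ i : ℕ, (a + ((i + 1 : ℕ) : ℝ) * ((b - a) / m)) - (a + i * ((b - a) / m)) =
      (b - a) / m := fun i => by push_cast; ring
  have h0 : 0 ≤ (b - a) / m := div_nonneg (sub_nonneg.2 hab) hm0.le
  refine ⟨m, fun i => a + i * ((b - a) / m), fun i => a + i * ((b - a) / m), by simp, ?_,
    fun i _ => ⟨le_rfl, ?_, ?_⟩⟩
  · field_simp; ring
  · linarith [hstep i]
  · rw [hstep, div_lt_iff₀ hm0, mul_comm]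
    exact (div_lt_iff₀ hδ).1 hm

/-- Used to complete a partition of [0, t] to one of [0, T], where the reflection condition can be
applied. -/
theorem IsTaggedPartition.exists_append {a b c δ : ℝ} {m m' : ℕ} {τ ξ τ' ξ' : ℕ → ℝ}
    (h : IsTaggedPartition a b δ m τ ξ) (h' : IsTaggedPartition b c δ m' τ' ξ') :
    ∃ τ'' ξ'', IsTaggedPartition a c δ (m + m') τ'' ξ'' ∧ ∀ g L : ℝ → H,
      stieltjesSum g L (m + m') τ'' ξ'' = stieltjesSum g L m τ ξ + stieltjesSum g L m' τ' ξ' := by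
  -- There is one more node than there are tags: the node with index m is the common point b, while
  -- the tag with index m already belongs to the second partition.
  let τ'' : ℕ → ℝ := fun i => if i ≤ m then τ i else τ' (i - m)
  let ξ'' : ℕ → ℝ := fun i => if i < m then ξ i else ξ' (i - m)
  have e1 : ∀ i ≤ m, τ'' i = τ i := fun i hi => if_pos hi
  have e2 : ∀ i, τ'' (m + i) = τ' i := by
    intro i
    rcases Nat.eq_zero_or_pos i with rfl | hi
    · rw [add_zero, e1 m le_rfl, h.right, h'.left]
    · simp only [τ'']
      rw [if_neg (by omega), Nat.add_sub_cancel_left]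
  have e3 : ∀ i < m, ξ'' i = ξ i := fun i hi => if_pos hi
  have e4 : ∀ i, ξ'' (m + i) = ξ' i := by
    intro i
    simp only [ξ'']
    rw [if_neg (by omega), Nat.add_sub_cancel_left]
  refine ⟨τ'', ξ'', ⟨by rw [e1 0 (Nat.zero_le _), h.left], by rw [e2, h'.right], fun i hi => ?_⟩,
    fun g L => ?_⟩
  · rcases lt_or_ge i m with him | him
    · rw [e1 i him.le, e1 (i + 1) him, e3 i him]
      exact h.tag i him
    · obtain ⟨j, rfl⟩ := Nat.exists_eq_add_of_le him
      rw [add_assoc, e2, e2, e4]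
      exact h'.tag j (by omega)
  · simp only [stieltjesSum]
    rw [Finset.sum_range_add]
    congr 1
    · refine Finset.sum_congr rfl fun i hi => ?_
      rw [Finset.mem_range] at hi
      rw [e1 i hi.le, e1 (i + 1) hi, e3 i hi]
    · refine Finset.sum_congr rfl fun i _ => ?_
      rw [add_assoc, e2, e2, e4]

/-- Bounded variation of L enters the whole argument only here and in the choice of the short
interval to which this bound is applied. -/
theorem IsTaggedPartition.abs_stieltjesSum_le {a b δ : ℝ} {m : ℕ} {τ ξ : ℕ → ℝ}
    (h : IsTaggedPartition a b δ m τ ξ) {g L : ℝ → H} {M V : ℝ} (hM : 0 ≤ M)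
    (hg : ∀ s ∈ Icc a b, ‖g s‖ ≤ M) (hV : 0 ≤ V)
    (hL : eVariationOn L (Icc a b) ≤ ENNReal.ofReal V) :
    |stieltjesSum g L m τ ξ| ≤ M * V := by
  have h1 : ∑ i ∈ Finset.range m, ‖L (τ (i + 1)) - L (τ i)‖ ≤ V := by
    have h2 : ∑ i ∈ Finset.range m, edist (L (τ (i + 1))) (L (τ i)) ≤ eVariationOn L (Icc a b) :=
      eVariationOn.sum_le_of_monotoneOn_Iic (fun i _ j hj hij => h.le hij hj) fun i hi => h.mem hi
    have h3 := h2.trans hL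
    simp_rw [edist_dist, dist_eq_norm] at h3
    rw [← ENNReal.ofReal_sum_of_nonneg fun i _ => norm_nonneg _] at h3
    exact (ENNReal.ofReal_le_ofReal_iff hV).1 h3
  calc |stieltjesSum g L m τ ξ|
      ≤ ∑ i ∈ Finset.range m, |⟪g (ξ i), L (τ (i + 1)) - L (τ i)⟫_ℝ| :=
        Finset.abs_sum_le_sum_abs _ _
    _ ≤ ∑ i ∈ Finset.range m, M * ‖L (τ (i + 1)) - L (τ i)‖ := by
        refine Finset.sum_le_sum fun i hi => (abs_real_inner_le_norm _ _).trans ?_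
        exact mul_le_mul_of_nonneg_right (hg _ (h.tag_mem (Finset.mem_range.1 hi)))
          (norm_nonneg _)
    _ ≤ M * V := by rw [← Finset.mul_sum]; exact mul_le_mul_of_nonneg_left h1 hM

theorem stieltjesSum_congr {a b δ : ℝ} {m : ℕ} {τ ξ : ℕ → ℝ}
    (h : IsTaggedPartition a b δ m τ ξ) {g g' : ℝ → H} (L : ℝ → H)
    (hg : ∀ s ∈ Icc a b, g s = g' s) : stieltjesSum g L m τ ξ = stieltjesSum g' L m τ ξ :=
  Finset.sum_congr rfl fun i hi => by rw [hg _ (h.tag_mem (Finset.mem_range.1 hi))]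

/-- The lower limit of the Riemann-Stieltjes sums of `∫₀ᵗ (p, dL)` is nonnegative. -/
def StieltjesNonneg (p L : ℝ → H) (t : ℝ) : Prop :=
  ∀ η > 0, ∃ δ > 0, ∀ (m : ℕ) (τ ξ : ℕ → ℝ), IsTaggedPartition 0 t δ m τ ξ →
    -η ≤ stieltjesSum p L m τ ξ

/-- The reflection condition on `[0,T]` implies the one on `[0,t]`. -/
theorem stieltjesNonneg_of_reflection {T t : ℝ} (ht : t ∈ Icc 0 T) {u v L : ℝ → H}
    (hu : ContinuousOn u (Icc 0 T)) (hu1 : ∀ s ∈ Icc 0 T, ‖u s‖ ≤ 1)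
    (hv : ContinuousOn v (Icc 0 T)) (hv1 : ∀ s ∈ Icc 0 T, ‖v s‖ ≤ 1)
    (hL : ContinuousOn L (Icc 0 T)) (hLbv : BoundedVariationOn L (Icc 0 T))
    (href : ∀ φ : ℝ → H, ContinuousOn φ (Icc 0 T) → (∀ t ∈ Icc 0 T, ‖φ t‖ ≤ 1) →
      ∃ I : ℝ, HasRSIntegral (fun t => φ t - u t) L 0 T I ∧ 0 ≤ I) :
    StieltjesNonneg (fun s => v s - u s) L t := by
  intro η hη
  rcases eq_or_lt_of_le ht.2 with rfl | htT
  · obtain ⟨I, hI, hI0⟩ := href v hv hv1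
    obtain ⟨δ, hδ, h⟩ := hI η hη
    refine ⟨δ, hδ, fun m τ ξ hp => ?_⟩
    have := h m τ ξ hp.left hp.right hp.tag
    have h2 := (abs_lt.1 this).1
    simp only [stieltjesSum]
    linarith
  -- Since L is continuous at t, its variation puts no atom there, so the variation over [t, t']
  -- tends to zero as t' decreases to t.
  obtain ⟨t', ht', hvar⟩ : ∃ t' ∈ Ioc t T, eVariationOn L (Icc t t') ≤ ENNReal.ofReal (η / 8) := by
    have h1 := hLbv.tendsto_eVariationOn_Icc_zero_right t ((hL t ht).mono inter_subset_left)
    have h2 := h1.eventually (Iic_mem_nhds (show (0 : ℝ≥0∞) < ENNReal.ofReal (η / 8) by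
      simpa using hη))
    have h3 : 𝓝[Ioc t T] t ≤ 𝓝[Icc 0 T] t :=
      nhdsWithin_mono _ fun x hx => ⟨ht.1.trans hx.1.le, hx.2⟩
    have : (𝓝[Ioc t T] t).NeBot := by
      rw [nhdsWithin_Ioc_eq_nhdsGT htT]; infer_instance
    obtain ⟨t', h4, h5⟩ := ((h2.filter_mono h3).and self_mem_nhdsWithin).exists
    refine ⟨t', h5, ?_⟩
    have e : Icc 0 T ∩ Icc t t' = Icc t t' :=
      inter_eq_right.2 (Icc_subset_Icc ht.1 h5.2)
    rw [e] at h4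
    exact h4
  have htt' : 0 < t' - t := sub_pos.2 ht'.1
  -- A cutoff equal to 1 up to t and to 0 after t'. The test path (1-θ)u + θv stays in the ball by
  -- convexity, and its difference from u is θ(v - u).
  let θ : ℝ → ℝ := fun s => max 0 (min 1 ((t' - s) / (t' - t)))
  have hθc : Continuous θ := by fun_prop
  have hθ0 : ∀ s, 0 ≤ θ s := fun s => le_max_left _ _
  have hθ1 : ∀ s, θ s ≤ 1 := fun s => max_le zero_le_one (min_le_left _ _)
  have hθt : ∀ s ≤ t, θ s = 1 := fun s hs => by
    have : 1 ≤ (t' - s) / (t' - t) := by rw [one_le_div htt']; linarith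
    simp only [θ]
    rw [min_eq_left this, max_eq_right zero_le_one]
  have hθt' : ∀ s, t' ≤ s → θ s = 0 := fun s hs => by
    have : (t' - s) / (t' - t) ≤ 0 := div_nonpos_of_nonpos_of_nonneg (by linarith) htt'.le
    simp only [θ]
    rw [min_eq_right (this.trans zero_le_one), max_eq_left this]
  let φ : ℝ → H := fun s => (1 - θ s) • u s + θ s • v s
  have hφc : ContinuousOn φ (Icc 0 T) :=
    ((continuousOn_const.sub hθc.continuousOn).smul hu).add (hθc.continuousOn.smul hv)
  have hφ1 : ∀ s ∈ Icc 0 T, ‖φ s‖ ≤ 1 := fun s hs => by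
    refine (norm_add_le _ _).trans ?_
    rw [norm_smul, norm_smul, Real.norm_of_nonneg (hθ0 s),
      Real.norm_of_nonneg (sub_nonneg.2 (hθ1 s))]
    have a1 := mul_le_mul_of_nonneg_left (hu1 s hs) (sub_nonneg.2 (hθ1 s))
    have a2 := mul_le_mul_of_nonneg_left (hv1 s hs) (hθ0 s)
    linarith
  have hφu : ∀ s, φ s - u s = θ s • (v s - u s) := fun s => by
    simp only [φ, sub_smul, smul_sub, one_smul]; abel
  obtain ⟨I, hI, hI0⟩ := href φ hφc hφ1
  obtain ⟨δ, hδ, h⟩ := hI (η / 2) (by positivity)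
  refine ⟨δ, hδ, fun m τ ξ hp => ?_⟩
  -- The given partition of [0, t] is continued through [t, t'] and [t', T] with the same mesh. The
  -- last sum vanishes and the middle one is at most 2 · η/8, which with the tolerance η/2 stays
  -- below η.
  obtain ⟨m₁, τ₁, ξ₁, h₁⟩ := exists_isTaggedPartition ht'.1.le hδ
  obtain ⟨m₂, τ₂, ξ₂, h₂⟩ := exists_isTaggedPartition ht'.2 hδ
  obtain ⟨τ₃, ξ₃, h₃, e₃⟩ := hp.exists_append (H := H) h₁
  obtain ⟨τ₄, ξ₄, h₄, e₄⟩ := h₃.exists_append (H := H) h₂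
  have h5 := (abs_lt.1 (h _ τ₄ ξ₄ h₄.left h₄.right h₄.tag)).1
  have h6 : stieltjesSum (fun s => φ s - u s) L _ τ₄ ξ₄ = _ := e₄ _ _
  rw [e₃, stieltjesSum_congr hp (g' := fun s => v s - u s) L fun s hs => by
    rw [hφu, hθt s hs.2, one_smul], stieltjesSum_congr h₂ (g' := fun _ => 0) L fun s hs => by
    rw [hφu, hθt' s hs.1, zero_smul]] at h6
  have h7 : stieltjesSum (fun _ => (0 : H)) L m₂ τ₂ ξ₂ = 0 := by simp [stieltjesSum]
  have h8 := h₁.abs_stieltjesSum_le (g := fun s => φ s - u s) (M := 2) (by norm_num)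
    (fun s hs => by
      have hs' : s ∈ Icc 0 T := ⟨ht.1.trans hs.1, hs.2.trans ht'.2⟩
      refine (norm_sub_le _ _).trans ?_
      linarith [hφ1 s hs', hu1 s hs']) (by positivity) hvar
  have h9 := (abs_le.1 h8).2
  simp only [stieltjesSum] at h5 h6 h7 h9 ⊢
  linarith

/-- The nodes r + ih, completed by 0 and t, partition [0, t]. Pairing with p(s) + p(s+h) adds the
left-tagged and the right-tagged sum over the same nodes, each at least -η. Removing the two end
intervals from both sums costs four terms of size at most Mρ. -/
theorem averagedStieltjes_sum_ge {p L : ℝ → H} {t δ η M ρ : ℝ} {m : ℕ} (ht : 0 < t)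
    (hsum : ∀ (m : ℕ) (τ ξ : ℕ → ℝ), IsTaggedPartition 0 t δ m τ ξ →
      -η ≤ stieltjesSum p L m τ ξ)
    (hM : ∀ s ∈ Icc 0 t, ‖p s‖ ≤ M)
    (hρ : ∀ a ∈ Icc 0 t, ∀ b ∈ Icc 0 t, |a - b| ≤ t / (m + 1) → ‖L a - L b‖ ≤ ρ)
    (hδ : t / (m + 1) < δ) {r : ℝ} (hr : r ∈ Icc 0 (t / (m + 1))) :
    -(2 * η + 4 * (M * ρ)) ≤ ∑ i ∈ Finset.range m,
      ⟪L (r + i * (t / (m + 1)) + t / (m + 1)) - L (r + i * (t / (m + 1))),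
        p (r + i * (t / (m + 1))) + p (r + i * (t / (m + 1)) + t / (m + 1))⟫_ℝ := by
  set h := t / ((m : ℝ) + 1) with hh
  have hm1 : (0 : ℝ) < (m : ℝ) + 1 := by positivity
  have h0 : 0 < h := div_pos ht hm1
  have hth : t = m * h + h := by rw [hh]; field_simp
  -- Nodes 1 to m+1 are the shifted grid. Because 0 ≤ r ≤ h and (m+1)h = t, clamping to [0, t] turns
  -- node 0 into 0 and node m+2 into t.
  let τ : ℕ → ℝ := fun j => max 0 (min t (r + (j - 1) * h))
  have hτ0 : τ 0 = 0 := by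
    simp only [τ, Nat.cast_zero]
    rw [max_eq_left]
    exact (min_le_right _ _).trans (by linarith [hr.2])
  have hτe : τ (m + 2) = t := by
    simp only [τ]
    push_cast
    rw [min_eq_left (by linarith [hr.1]), max_eq_right ht.le]
  have hτi : ∀ i ≤ m, τ (i + 1) = r + i * h := by
    intro i hi
    have h1 : (i : ℝ) * h ≤ m * h := mul_le_mul_of_nonneg_right (by exact_mod_cast hi) h0.le
    have h2 : 0 ≤ (i : ℝ) * h := by positivity
    simp only [τ]
    push_cast
    rw [add_sub_cancel_right, min_eq_right (by linarith [hr.2]), max_eq_right (by linarith [hr.1])]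
  have hτmono : ∀ j, τ j ≤ τ (j + 1) := fun j => by
    simp only [τ]
    push_cast
    exact max_le_max le_rfl (min_le_min le_rfl (by linarith))
  have hτh : ∀ j, τ (j + 1) - τ j ≤ h := fun j => by
    simp only [τ]
    push_cast
    rcases max_cases 0 (min t (r + ((j : ℝ) + 1 - 1) * h)) with ⟨e1, _⟩ | ⟨e1, _⟩ <;>
    rcases max_cases 0 (min t (r + ((j : ℝ) - 1) * h)) with ⟨e2, _⟩ | ⟨e2, _⟩ <;>
    rcases min_cases t (r + ((j : ℝ) + 1 - 1) * h) with ⟨e3, _⟩ | ⟨e3, _⟩ <;>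
    rcases min_cases t (r + ((j : ℝ) - 1) * h) with ⟨e4, _⟩ | ⟨e4, _⟩ <;>
    rw [e1, e2] <;> linarith
  have hl : IsTaggedPartition 0 t δ (m + 2) τ τ :=
    ⟨hτ0, hτe, fun i _ => ⟨le_rfl, hτmono i, (hτh i).trans_lt hδ⟩⟩
  have hrt : IsTaggedPartition 0 t δ (m + 2) τ (fun i => τ (i + 1)) :=
    ⟨hτ0, hτe, fun i _ => ⟨hτmono i, le_rfl, (hτh i).trans_lt hδ⟩⟩
  have hend : ∀ i j, i < m + 2 → j ≤ m + 2 → |⟪p (τ j), L (τ (i + 1)) - L (τ i)⟫_ℝ| ≤ M * ρ := by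
    intro i j hi hj
    refine (abs_real_inner_le_norm _ _).trans ?_
    refine mul_le_mul (hM _ (hl.mem hj)) (hρ _ (hl.mem hi) _ (hl.mem hi.le) ?_) (norm_nonneg _)
      ((norm_nonneg _).trans (hM _ (hl.mem hj)))
    rw [abs_of_nonneg (sub_nonneg.2 (hτmono i))]
    exact hτh i
  have s1 := hsum _ _ _ hl
  have s2 := hsum _ _ _ hrt
  rw [stieltjesSum, Finset.sum_range_succ, Finset.sum_range_succ'] at s1 s2
  have e0 := (abs_le.1 (hend 0 0 (by omega) (by omega))).2
  have e1 := (abs_le.1 (hend 0 1 (by omega) (by omega))).2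
  have e2 := (abs_le.1 (hend (m + 1) (m + 1) (by omega) (by omega))).2
  have e3 := (abs_le.1 (hend (m + 1) (m + 2) (by omega) (by omega))).2
  have e4 : ∑ i ∈ Finset.range m, ⟪L (r + i * h + h) - L (r + i * h),
        p (r + i * h) + p (r + i * h + h)⟫_ℝ =
      (∑ i ∈ Finset.range m, ⟪p (τ (i + 1)), L (τ (i + 1 + 1)) - L (τ (i + 1))⟫_ℝ) +
      ∑ i ∈ Finset.range m, ⟪p (τ (i + 1 + 1)), L (τ (i + 1 + 1)) - L (τ (i + 1))⟫_ℝ := by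
    rw [← Finset.sum_add_distrib]
    refine Finset.sum_congr rfl fun i hi => ?_
    have hi := Finset.mem_range.1 hi
    have e5 : τ (i + 1 + 1) = r + i * h + h := by
      rw [hτi (i + 1) hi]; push_cast; ring
    rw [e5, hτi i hi.le, real_inner_comm, inner_add_left]
  rw [e4]
  norm_num at s1 s2 e0 e1 e2 e3 ⊢
  linarith

/-- The averaged sums inherit the nonnegativity. -/
theorem StieltjesNonneg.eventually_averagedStieltjes_ge {p L : ℝ → H} {t : ℝ} (ht : 0 < t)
    (hp : ContinuousOn p (Icc 0 t)) (hL : ContinuousOn L (Icc 0 t)) (hs : StieltjesNonneg p L t)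
    {η : ℝ} (hη : 0 < η) :
    ∀ᶠ m : ℕ in atTop, -η ≤ averagedStieltjes L p t (t / (m + 1)) := by
  obtain ⟨M, hM⟩ := isCompact_Icc.exists_bound_of_continuousOn hp
  have hM0 : 0 ≤ M := (norm_nonneg _).trans (hM 0 ⟨le_rfl, ht.le⟩)
  obtain ⟨δ, hδ, hsum⟩ := hs (η / 4) (by positivity)
  -- Chosen so that 2 · (η/4) + 4Mρ ≤ η; adding 1 to M keeps the denominator positive.
  set ρ := η / (8 * (M + 1)) with hρd
  have hρ0 : 0 < ρ := by positivity
  have hMρ : M * ρ ≤ η / 8 := by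
    rw [hρd, mul_div_assoc', div_le_div_iff₀ (by positivity) (by norm_num)]
    nlinarith
  obtain ⟨κ, hκ, huc⟩ := Metric.uniformContinuousOn_iff_le.1
    (isCompact_Icc.uniformContinuousOn_of_continuous hL) ρ hρ0
  have hlim : Tendsto (fun m : ℕ => t / ((m : ℝ) + 1)) atTop (𝓝 0) := by
    have := (tendsto_one_div_add_atTop_nhds_zero_nat (𝕜 := ℝ)).const_mul t
    simpa [div_eq_mul_inv] using this
  filter_upwards [hlim.eventually (Iio_mem_nhds hδ), hlim.eventually (Iio_mem_nhds hκ)] with m h1 h2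
  have hm1 : (0 : ℝ) < (m : ℝ) + 1 := by positivity
  have hsumge := fun r hr => averagedStieltjes_sum_ge (m := m) ht hsum hM
    (fun a ha b hb hab => by
      have := huc a ha b hb (by rw [Real.dist_eq]; exact hab.trans (le_of_lt h2))
      rwa [dist_eq_norm] at this) h1 (r := r) hr
  set h := t / ((m : ℝ) + 1) with hh
  have h0 : 0 < h := div_pos ht hm1
  have hth : t = m * h + h := by rw [hh]; field_simp
  set F : ℝ → ℝ := fun s => ⟪L (s + h) - L s, p s + p (s + h)⟫_ℝ with hF
  have hFc : ContinuousOn F (Icc 0 (t - h)) := by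
    have c1 : ContinuousOn (fun s => s + h) (Icc 0 (t - h)) := by fun_prop
    have m1 : MapsTo (fun s => s + h) (Icc 0 (t - h)) (Icc 0 t) := fun s hs =>
      ⟨by linarith [hs.1], by linarith [hs.2]⟩
    have m2 : Icc 0 (t - h) ⊆ Icc 0 t := Icc_subset_Icc le_rfl (by linarith)
    exact ((hL.comp c1 m1).sub (hL.mono m2)).inner ((hp.mono m2).add (hp.comp c1 m1))
  have hFi : ∀ i < m, IntervalIntegrable F volume ((i : ℝ) * h) (((i + 1 : ℕ) : ℝ) * h) := by
    intro i hi
    refine (hFc.mono ?_).intervalIntegrable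
    have hi' : ((i + 1 : ℕ) : ℝ) ≤ m := by exact_mod_cast hi
    have h3 := mul_le_mul_of_nonneg_right hi' h0.le
    have h4 : (i : ℝ) * h ≤ ((i + 1 : ℕ) : ℝ) * h :=
      mul_le_mul_of_nonneg_right (by push_cast; linarith) h0.le
    rw [uIcc_of_le h4]
    exact Icc_subset_Icc (by positivity) (by linarith)
  have hFi' : ∀ i ∈ Finset.range m, IntervalIntegrable (fun r => F (r + i * h)) volume 0 h := by
    intro i hi
    have := (hFi i (Finset.mem_range.1 hi)).comp_add_right ((i : ℝ) * h)
    convert this using 1 <;> push_cast <;> ring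
  -- Since t - h = mh, the interval splits into m cells of length h; moving each back to [0, h]
  -- gives the integral over the offset r of the grid sums.
  have hint : ∫ s in (0 : ℝ)..(t - h), F s =
      ∫ r in (0 : ℝ)..h, ∑ i ∈ Finset.range m, F (r + i * h) := by
    rw [intervalIntegral.integral_finsetSum hFi']
    have e1 := intervalIntegral.sum_integral_adjacent_intervals (f := F) (μ := volume)
      (a := fun i : ℕ => (i : ℝ) * h) (n := m) hFi
    rw [Nat.cast_zero, zero_mul] at e1
    rw [show t - h = m * h by linarith, ← e1]
    refine Finset.sum_congr rfl fun i _ => ?_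
    rw [intervalIntegral.integral_comp_add_right, zero_add]
    congr 1
    push_cast; ring
  have hlow : ∫ _ in (0 : ℝ)..h, -η ≤ ∫ r in (0 : ℝ)..h, ∑ i ∈ Finset.range m, F (r + i * h) := by
    refine intervalIntegral.integral_mono_on h0.le (by simp)
      (by simpa [Finset.sum_fn] using IntervalIntegrable.sum (Finset.range m) hFi') fun r hr => ?_
    refine le_trans ?_ (hsumge r hr)
    linarith
  rw [intervalIntegral.integral_const, sub_zero, smul_eq_mul, ← hint] at hlow
  rw [averagedStieltjes, inv_mul_eq_div, le_div_iff₀ h0]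
  linarith

/-- The limit is known to exist, so its sign can be read off along the sequence h = t/(m+1), for
which the averages decompose into grid sums. -/
theorem tendsto_averagedStieltjes_nonneg {p L : ℝ → H} {t c : ℝ} (ht : 0 < t)
    (hp : ContinuousOn p (Icc 0 t)) (hL : ContinuousOn L (Icc 0 t)) (hs : StieltjesNonneg p L t)
    (hc : Tendsto (averagedStieltjes L p t) (𝓝[>] 0) (𝓝 c)) : 0 ≤ c := by
  have hlim : Tendsto (fun m : ℕ => t / ((m : ℝ) + 1)) atTop (𝓝[>] 0) := by
    refine tendsto_nhdsWithin_iff.2 ⟨?_, Eventually.of_forall fun m => div_pos ht (by positivity)⟩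
    have := (tendsto_one_div_add_atTop_nhds_zero_nat (𝕜 := ℝ)).const_mul t
    simpa [div_eq_mul_inv] using this
  refine le_of_forall_pos_le_add fun η hη => ?_
  have := ge_of_tendsto (hc.comp hlim) (hs.eventually_averagedStieltjes_ge ht hp hL hη)
  linarith

/-- The averaged sums are linear in the integrand. -/
theorem averagedStieltjes_linear {L x y : ℝ → H} {t h : ℝ} (hh : h ∈ Ioo 0 t)
    (hL : ContinuousOn L (Icc 0 t)) (hx : ContinuousOn x (Icc 0 t))
    (hy : ContinuousOn y (Icc 0 t)) (a b : ℝ) :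
    averagedStieltjes L (fun s => a • x s + b • y s) t h =
      a * averagedStieltjes L x t h + b * averagedStieltjes L y t h := by
  have c1 : ContinuousOn (fun s => s + h) (Icc 0 (t - h)) := by fun_prop
  have m1 : MapsTo (fun s => s + h) (Icc 0 (t - h)) (Icc 0 t) := fun s hs =>
    ⟨by linarith [hs.1, hh.1], by linarith [hs.2]⟩
  have m2 : Icc 0 (t - h) ⊆ Icc 0 t := Icc_subset_Icc le_rfl (by linarith [hh.1])
  have hi : ∀ z : ℝ → H, ContinuousOn z (Icc 0 t) →
      IntervalIntegrable (fun s => ⟪L (s + h) - L s, z s + z (s + h)⟫_ℝ) volume 0 (t - h) := by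
    intro z hz
    refine ContinuousOn.intervalIntegrable ?_
    rw [uIcc_of_le (by linarith [hh.2])]
    exact ((hL.comp c1 m1).sub (hL.mono m2)).inner ((hz.mono m2).add (hz.comp c1 m1))
  have e : ∀ s, ⟪L (s + h) - L s, (a • x s + b • y s) + (a • x (s + h) + b • y (s + h))⟫_ℝ =
      a * ⟪L (s + h) - L s, x s + x (s + h)⟫_ℝ + b * ⟪L (s + h) - L s, y s + y (s + h)⟫_ℝ := by
    intro s
    simp only [inner_add_right, real_inner_smul_right]
    ring
  simp only [averagedStieltjes, e]
  rw [intervalIntegral.integral_add ((hi x hx).const_mul a) ((hi y hy).const_mul b),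
    intervalIntegral.integral_const_mul, intervalIntegral.integral_const_mul]
  ring

end

section

/-! ### Integral inequalities -/

theorem integral_mul_le_of_le {b y : ℝ → ℝ} {s t M : ℝ} (hst : s ≤ t)
    (hb : IntervalIntegrable b volume s t) (hb0 : ∀ r ∈ Icc s t, 0 ≤ b r)
    (hy : ContinuousOn y (Icc s t)) (hM : ∀ r ∈ Icc s t, y r ≤ M) :
    ∫ r in s..t, b r * y r ≤ M * ∫ r in s..t, b r := by
  rw [← intervalIntegral.integral_const_mul]
  refine intervalIntegral.integral_mono_on hst
    (hb.mul_continuousOn (by rwa [uIcc_of_le hst])) (hb.const_mul M) fun r hr => ?_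
  rw [mul_comm]
  exact mul_le_mul_of_nonneg_right (hM r hr) (hb0 r hr)

/-- Grönwall's inequality with an integrable coefficient; the constant depends only on a bound of
the integral of the coefficient. -/
theorem exists_gronwall_const (R : ℝ) : ∃ C : ℝ, 0 ≤ C ∧ ∀ (T a : ℝ) (b y : ℝ → ℝ),
    0 ≤ T → 0 ≤ a → IntervalIntegrable b volume 0 T → (∀ s ∈ Icc 0 T, 0 ≤ b s) →
    ContinuousOn y (Icc 0 T) → (∀ s ∈ Icc 0 T, 0 ≤ y s) →
    (∀ t ∈ Icc 0 T, y t ≤ a + ∫ s in (0 : ℝ)..t, b s * y s) →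
    ∫ s in (0 : ℝ)..T, b s ≤ R → ∀ t ∈ Icc 0 T, y t ≤ C * a := by
  -- Induction on the mass of the coefficient in units of 1/2: a piece on which b has integral at
  -- most 1/2 can be absorbed into the left side.
  suffices H : ∀ m : ℕ, ∃ C : ℝ, 0 ≤ C ∧ ∀ (T a : ℝ) (b y : ℝ → ℝ),
      0 ≤ T → 0 ≤ a → IntervalIntegrable b volume 0 T → (∀ s ∈ Icc 0 T, 0 ≤ b s) →
      ContinuousOn y (Icc 0 T) → (∀ s ∈ Icc 0 T, 0 ≤ y s) →
      (∀ t ∈ Icc 0 T, y t ≤ a + ∫ s in (0 : ℝ)..t, b s * y s) →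
      ∫ s in (0 : ℝ)..T, b s ≤ (m : ℝ) / 2 → ∀ t ∈ Icc 0 T, y t ≤ C * a by
    obtain ⟨m, hm⟩ := exists_nat_ge (2 * R)
    obtain ⟨C, hC0, hC⟩ := H m
    exact ⟨C, hC0, fun T a b y h1 h2 h3 h4 h5 h6 h7 h8 =>
      hC T a b y h1 h2 h3 h4 h5 h6 h7 (by linarith)⟩
  have mono : ∀ {T : ℝ} {b : ℝ → ℝ}, IntervalIntegrable b volume 0 T → ∀ s t, 0 ≤ s → s ≤ t →
      t ≤ T → IntervalIntegrable b volume s t := fun hb s t h1 h2 h3 => by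
    refine hb.mono_set ?_
    rw [uIcc_of_le h2, uIcc_of_le (h1.trans (h2.trans h3))]
    exact Icc_subset_Icc h1 h3
  have bnonneg : ∀ {T : ℝ} {b : ℝ → ℝ}, (∀ s ∈ Icc 0 T, 0 ≤ b s) → ∀ s t, 0 ≤ s → s ≤ t →
      t ≤ T → 0 ≤ ∫ r in s..t, b r := fun hb s t h1 h2 h3 =>
    intervalIntegral.integral_nonneg h2 fun r hr => hb r ⟨h1.trans hr.1, hr.2.trans h3⟩
  intro m
  induction m with
  | zero =>
    refine ⟨1, zero_le_one, fun T a b y hT ha hb hb0 hy hy0 hint hβ t ht => ?_⟩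
    obtain ⟨M, hM⟩ := isCompact_Icc.exists_bound_of_continuousOn hy
    have h1 := integral_mul_le_of_le ht.1 (mono hb 0 t le_rfl ht.1 ht.2)
      (fun r hr => hb0 r ⟨hr.1, hr.2.trans ht.2⟩) (hy.mono (Icc_subset_Icc le_rfl ht.2))
      (fun r hr => (le_abs_self _).trans (hM r ⟨hr.1, hr.2.trans ht.2⟩))
    have h2 : ∫ s in (0 : ℝ)..t, b s = 0 := by
      refine le_antisymm ?_ (bnonneg hb0 0 t le_rfl ht.1 ht.2)
      have h3 := intervalIntegral.integral_add_adjacent_intervals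
        (mono hb 0 t le_rfl ht.1 ht.2) (mono hb t T ht.1 ht.2 le_rfl)
      have h4 := bnonneg hb0 t T ht.1 ht.2 le_rfl
      norm_num at hβ
      linarith
    rw [h2, mul_zero] at h1
    linarith [hint t ht]
  | succ m ih =>
    obtain ⟨C, hC0, hC⟩ := ih
    refine ⟨2 + (m + 1) * C, by positivity,
      fun T a b y hT ha hb hb0 hy hy0 hint hβ t ht => ?_⟩
    have hβc : ContinuousOn (fun t => ∫ s in (0 : ℝ)..t, b s) (Icc 0 T) := by
      have := intervalIntegral.continuousOn_primitive_interval' hb left_mem_uIcc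
      rwa [uIcc_of_le hT] at this
    -- The time s is where the accumulated mass reaches m/2, or the total mass if that is smaller;
    -- the induction hypothesis covers [0, s] and at most 1/2 is left afterwards.
    obtain ⟨s, hs, hsβ⟩ : ∃ s ∈ Icc 0 T, ∫ r in (0 : ℝ)..s, b r =
        min ((m : ℝ) / 2) (∫ r in (0 : ℝ)..T, b r) := by
      refine intermediate_value_Icc hT hβc ⟨?_, min_le_right _ _⟩
      rw [intervalIntegral.integral_same]
      exact le_min (by positivity) (bnonneg hb0 0 T le_rfl hT le_rfl)
    have hsT : Icc 0 s ⊆ Icc 0 T := Icc_subset_Icc le_rfl hs.2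
    have ihs := hC s a b y hs.1 ha (mono hb 0 s le_rfl hs.1 hs.2) (fun r hr => hb0 r (hsT hr))
      (hy.mono hsT) (fun r hr => hy0 r (hsT hr)) (fun r hr => hint r (hsT hr))
      (hsβ.le.trans (min_le_left _ _))
    -- At a maximum point τ beyond s the inequality reads y(τ) ≤ a + (m/2) C a + y(τ)/2, hence y(τ)
    -- ≤ (2 + mC) a. If τ ≤ s, then y(τ) ≤ C a.
    obtain ⟨τ, hτ, hmax⟩ := isCompact_Icc.exists_isMaxOn (nonempty_Icc.2 hT) hy
    refine (hmax ht).trans ?_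
    change y τ ≤ _
    have hCa : 0 ≤ C * a := mul_nonneg hC0 ha
    have hmCa : 0 ≤ (m : ℝ) * (C * a) := by positivity
    rcases le_total τ s with h1 | h1
    · have := ihs τ ⟨hτ.1, h1⟩
      linarith
    · have i1 := integral_mul_le_of_le hs.1 (mono hb 0 s le_rfl hs.1 hs.2)
        (fun r hr => hb0 r (hsT hr)) (hy.mono hsT) ihs
      have i2 := integral_mul_le_of_le h1 (mono hb s τ hs.1 h1 hτ.2)
        (fun r hr => hb0 r ⟨hs.1.trans hr.1, hr.2.trans hτ.2⟩)
        (hy.mono (Icc_subset_Icc hs.1 hτ.2))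
        (fun r hr => hmax (a := r) ⟨hs.1.trans hr.1, hr.2.trans hτ.2⟩)
      have hby : ∀ p q, 0 ≤ p → p ≤ q → q ≤ T →
          IntervalIntegrable (fun r => b r * y r) volume p q := fun p q h2 h3 h4 =>
        (mono hb p q h2 h3 h4).mul_continuousOn (by
          rw [uIcc_of_le h3]; exact hy.mono (Icc_subset_Icc h2 h4))
      have i3 := intervalIntegral.integral_add_adjacent_intervals
        (hby 0 s le_rfl hs.1 hs.2) (hby s τ hs.1 h1 hτ.2)
      have i4 := intervalIntegral.integral_add_adjacent_intervals
        (mono hb 0 s le_rfl hs.1 hs.2) (mono hb s τ hs.1 h1 hτ.2)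
      have i5 := intervalIntegral.integral_add_adjacent_intervals
        (mono hb 0 τ le_rfl hτ.1 hτ.2) (mono hb τ T hτ.1 hτ.2 le_rfl)
      have i6 := bnonneg hb0 τ T hτ.1 hτ.2 le_rfl
      have i7 := hint τ hτ
      have hsβ' : ∫ r in (0 : ℝ)..s, b r ≤ m / 2 := hsβ.le.trans (min_le_left _ _)
      have i8 : ∫ r in s..τ, b r ≤ 1 / 2 := by
        push_cast at hβ
        rcases min_cases ((m : ℝ) / 2) (∫ r in (0 : ℝ)..T, b r) with ⟨e, _⟩ | ⟨e, _⟩ <;>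
          rw [e] at hsβ <;> linarith
      have i9 := mul_le_mul_of_nonneg_left i8 (hy0 τ hτ)
      have i10 := mul_le_mul_of_nonneg_left hsβ' hCa
      linarith

/-- A function with a strongly restoring drift stays small. -/
theorem le_of_restoring_drift {z : ℝ → ℝ} {T n α β : ℝ} (hn : 0 < n) (hα : 0 ≤ α) (hβ : 0 ≤ β)
    (hz : ContinuousOn z (Icc 0 T)) (hz0 : z 0 ≤ 0)
    (hineq : ∀ s t, 0 ≤ s → s ≤ t → t ≤ T →
      z t - z s ≤ α * (t - s) + β - n * ∫ r in s..t, max (z r) 0) :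
    ∀ t ∈ Icc 0 T, z t ≤ 2 * (α / n + β) := by
  intro t ht
  by_contra! hcon
  have hpos : 0 ≤ α / n + β := by positivity
  -- Let s be the last time before t with z ≤ μ. From s to t the drift is at most α - nμ, which is
  -- not positive since μ > α/n + β. The increase is therefore at most β < μ, whereas z must climb
  -- by at least μ.
  set μ := z t / 2 with hμ
  have hμ0 : 0 < μ := by linarith
  have hzt : ContinuousOn z (Icc 0 t) := hz.mono (Icc_subset_Icc le_rfl ht.2)
  have hcomp : IsCompact (Icc 0 t ∩ z ⁻¹' Iic μ) :=
    isCompact_Icc.of_isClosed_subset (hzt.preimage_isClosed_of_isClosed isClosed_Icc isClosed_Iic)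
      inter_subset_left
  obtain ⟨s, ⟨hs, hsμ⟩, hgr⟩ := hcomp.exists_isGreatest
    ⟨0, ⟨le_rfl, ht.1⟩, (hz0.trans hμ0.le : z 0 ≤ μ)⟩
  have hsμ' : z s ≤ μ := hsμ
  have hbig : ∀ r ∈ Ioo s t, μ ≤ max (z r) 0 := by
    intro r hr
    by_contra! h
    have h1 : z r ≤ μ := (le_max_left _ _).trans h.le
    exact absurd (hgr ⟨⟨hs.1.trans hr.1.le, hr.2.le⟩, h1⟩) (not_le.2 hr.1)
  have hint : ∫ _ in s..t, μ ≤ ∫ r in s..t, max (z r) 0 := by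
    refine intervalIntegral.integral_mono_on_of_le_Ioo hs.2 (by simp) ?_ hbig
    refine ContinuousOn.intervalIntegrable ?_
    rw [uIcc_of_le hs.2]
    exact (continuous_id.max continuous_const).comp_continuousOn
      (hzt.mono (Icc_subset_Icc hs.1 le_rfl))
  rw [intervalIntegral.integral_const, smul_eq_mul] at hint
  have h1 := hineq s t hs.1 hs.2 ht.2
  have h2 := mul_le_mul_of_nonneg_left hint hn.le
  have h3 : μ > α / n + β := by linarith
  have hts : 0 ≤ t - s := sub_nonneg.2 hs.2
  have h4 : (α / n + β) * (n * (t - s)) ≤ μ * (n * (t - s)) :=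
    mul_le_mul_of_nonneg_right h3.le (by positivity)
  have h5 : (α / n + β) * (n * (t - s)) = α * (t - s) + β * (n * (t - s)) := by field_simp
  have h6 : 0 ≤ β * (n * (t - s)) := by positivity
  have h7 : 0 ≤ α / n := by positivity
  linarith

end

section

variable {H : Type*} [NormedAddCommGroup H] [InnerProductSpace ℝ H]

/-! ### The projection onto the unit ball -/

/-- The two cases merge into one formula, which makes continuity evident. -/
theorem ballProj_eq (y : H) : ballProj y = (max 1 ‖y‖)⁻¹ • y := by
  unfold ballProj
  split_ifs with h
  · rw [max_eq_left h, inv_one, one_smul]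
  · rw [max_eq_right (not_le.1 h).le]

theorem continuous_sub_ballProj : Continuous fun y : H => y - ballProj y := by
  simp_rw [ballProj_eq]
  have h : Continuous fun y : H => (max 1 ‖y‖)⁻¹ :=
    (continuous_const.max continuous_norm).inv₀ fun y =>
      (zero_lt_one.trans_le (le_max_left 1 ‖y‖)).ne'
  fun_prop

/-- Outside the ball the right side is 2|y|(|y| - 1), which dominates (|y| + 1)(|y| - 1). This makes
the penalization a restoring drift for |u|² - 1. -/
theorem max_le_two_mul_inner_sub_ballProj (y : H) :
    max (‖y‖ ^ 2 - 1) 0 ≤ 2 * ⟪y - ballProj y, y⟫_ℝ := by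
  unfold ballProj
  split_ifs with h
  · rw [sub_self, inner_zero_left, mul_zero, max_le_iff]
    exact ⟨by nlinarith [norm_nonneg y], le_rfl⟩
  · have h1 : 1 < ‖y‖ := not_le.1 h
    rw [inner_sub_left, real_inner_smul_left, real_inner_self_eq_norm_sq]
    have h2 : ‖y‖⁻¹ * ‖y‖ ^ 2 = ‖y‖ := by field_simp
    rw [h2, max_le_iff]
    constructor <;> nlinarith

/-- Outside the ball y - π(y) is a positive multiple of y, and (y, z) ≤ |y| ≤ |y|² for z in the
ball. This sign lets the penalization be discarded in the comparison, whatever `n` is. -/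
theorem inner_sub_ballProj_nonneg (y : H) {z : H} (hz : ‖z‖ ≤ 1) :
    0 ≤ ⟪y - ballProj y, y - z⟫_ℝ := by
  unfold ballProj
  split_ifs with h
  · simp
  · have h1 : 1 < ‖y‖ := not_le.1 h
    have h2 : y - ‖y‖⁻¹ • y = (1 - ‖y‖⁻¹) • y := by rw [sub_smul, one_smul]
    rw [h2, real_inner_smul_left, inner_sub_right, real_inner_self_eq_norm_sq]
    refine mul_nonneg (sub_nonneg.2 (inv_le_one_of_one_le₀ h1.le)) ?_
    have h3 := real_inner_le_norm y z
    nlinarith [mul_le_mul_of_nonneg_left hz (norm_nonneg y)]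

variable [CompleteSpace H] {𝔸 : CoerciveOperator H}

/-! ### The coefficients -/

/-- Enlarging the constant by the values at 0 makes it nonnegative and lets it serve for linear
growth as well. -/
theorem LipschitzCoeff.exists_const {f : H → 𝔸.Vdual} {σ : H → H} (h : LipschitzCoeff 𝔸 f σ) :
    ∃ C : ℝ, 0 ≤ C ∧ (∀ u v : H, ‖f u - f v‖ ≤ C * ‖u - v‖) ∧ (∀ u v : H, ‖σ u - σ v‖ ≤ C * ‖u - v‖) ∧
      (∀ u, ‖f u‖ ≤ C * (1 + ‖u‖)) ∧ ∀ u, ‖σ u‖ ≤ C * (1 + ‖u‖) := by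
  obtain ⟨C, hC⟩ := h
  have h1 : ∀ u v : H, C * ‖u - v‖ ≤ (|C| + ‖f 0‖ + ‖σ 0‖) * ‖u - v‖ := fun u v =>
    mul_le_mul_of_nonneg_right (by
      have := le_abs_self C
      have := norm_nonneg (f 0)
      have := norm_nonneg (σ 0)
      linarith) (norm_nonneg _)
  have hf : ∀ u v : H, ‖f u - f v‖ ≤ (|C| + ‖f 0‖ + ‖σ 0‖) * ‖u - v‖ := fun u v => by
    linarith [hC u v, h1 u v, norm_nonneg (σ u - σ v)]
  have hσ : ∀ u v : H, ‖σ u - σ v‖ ≤ (|C| + ‖f 0‖ + ‖σ 0‖) * ‖u - v‖ := fun u v => by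
    linarith [hC u v, h1 u v, norm_nonneg (f u - f v)]
  refine ⟨|C| + ‖f 0‖ + ‖σ 0‖, by positivity, hf, hσ, fun u => ?_, fun u => ?_⟩
  · have h2 := hf u 0
    have h3 := norm_le_norm_add_norm_sub' (f u) (f 0)
    rw [sub_zero] at h2
    linarith [abs_nonneg C, norm_nonneg (σ 0)]
  · have h2 := hσ u 0
    have h3 := norm_le_norm_add_norm_sub' (σ u) (σ 0)
    rw [sub_zero] at h2
    linarith [abs_nonneg C, norm_nonneg (f 0)]

theorem LipschitzCoeff.continuous_f {f : H → 𝔸.Vdual} {σ : H → H} (h : LipschitzCoeff 𝔸 f σ) :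
    Continuous f := by
  obtain ⟨C, hC0, hf, -⟩ := h.exists_const
  exact (LipschitzWith.of_dist_le_mul (K := ⟨C, hC0⟩) fun u v => by
    rw [dist_eq_norm, dist_eq_norm]; exact hf u v).continuous

theorem LipschitzCoeff.continuous_σ {f : H → 𝔸.Vdual} {σ : H → H} (h : LipschitzCoeff 𝔸 f σ) :
    Continuous σ := by
  obtain ⟨C, hC0, -, hσ, -⟩ := h.exists_const
  exact (LipschitzWith.of_dist_le_mul (K := ⟨C, hC0⟩) fun u v => by
    rw [dist_eq_norm, dist_eq_norm]; exact hσ u v).continuous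

theorem BilinearAssumption.apply_self {B : 𝔸.V →ₗ[ℝ] 𝔸.V →ₗ[ℝ] 𝔸.Vdual}
    (hB : BilinearAssumption 𝔸 B) (u v : 𝔸.V) : B u v v = 0 := by
  have := hB.skew u v v
  linarith

/-- With w = u - v, bilinearity gives B(u,u) - B(v,v) = B(u,w) + B(w,v), and the first term vanishes
when paired with w. Only v, which has a uniform L²(V) bound, is left undifferenced. -/
theorem BilinearAssumption.apply_diff {B : 𝔸.V →ₗ[ℝ] 𝔸.V →ₗ[ℝ] 𝔸.Vdual}
    (hB : BilinearAssumption 𝔸 B) (u v : 𝔸.V) :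
    B u u (u - v) - B v v (u - v) = B (u - v) v (u - v) := by
  have h1 := hB.apply_self u (u - v)
  have h2 : B u (u - v) = B u u - B u v := map_sub (B u) u v
  have h3 : B (u - v) = B u - B v := map_sub B u v
  rw [h2, sub_apply] at h1
  rw [h3, LinearMap.sub_apply, sub_apply]
  linarith

/-- With equal outer arguments the square roots in the interpolation bound combine, and
skew-symmetry moves the test vector to the middle slot. The first bound serves the comparison, the
second the integrability of B(u,u), the third its continuity. -/
theorem BilinearAssumption.exists_const {B : 𝔸.V →ₗ[ℝ] 𝔸.V →ₗ[ℝ] 𝔸.Vdual}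
    (hB : BilinearAssumption 𝔸 B) : ∃ c : ℝ, 0 ≤ c ∧
      (∀ u v, |B u v u| ≤ c * ‖u‖ * ‖𝔸.incl u‖ * ‖v‖) ∧ (∀ u, ‖B u u‖ ≤ c * ‖u‖ * ‖𝔸.incl u‖) ∧
      ∀ u v, ‖B u v‖ ≤ c * ‖𝔸.incl‖ * ‖u‖ * ‖v‖ := by
  obtain ⟨c, hc, hb⟩ := hB.bound
  have h1 : ∀ u v, |B u v u| ≤ c * ‖u‖ * ‖𝔸.incl u‖ * ‖v‖ := fun u v => by
    refine (hb u v u).trans (le_of_eq ?_)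
    have e1 := Real.mul_self_sqrt (norm_nonneg u)
    have e2 := Real.mul_self_sqrt (norm_nonneg (𝔸.incl u))
    calc _ = c * (Real.sqrt ‖u‖ * Real.sqrt ‖u‖) *
        (Real.sqrt ‖𝔸.incl u‖ * Real.sqrt ‖𝔸.incl u‖) * ‖v‖ := by ring
      _ = _ := by rw [e1, e2]
  refine ⟨c, hc.le, h1, fun u => ?_, fun u v => ?_⟩
  · refine ContinuousLinearMap.opNorm_le_bound _ (by positivity) fun w => ?_
    rw [hB.skew, norm_neg]
    exact h1 u w
  · refine ContinuousLinearMap.opNorm_le_bound _ (by positivity) fun w => ?_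
    rw [hB.skew, norm_neg]
    refine (hb u w v).trans (mul_le_mul_of_nonneg_right ?_ (norm_nonneg w))
    have e : ∀ u : 𝔸.V, Real.sqrt ‖u‖ * Real.sqrt ‖𝔸.incl u‖ ≤ Real.sqrt ‖𝔸.incl‖ * ‖u‖ := by
      intro u
      rw [← Real.sqrt_mul (norm_nonneg _)]
      refine Real.sqrt_le_iff.2 ⟨by positivity, ?_⟩
      rw [mul_pow, Real.sq_sqrt (norm_nonneg _)]
      nlinarith [mul_le_mul_of_nonneg_left (𝔸.incl.le_opNorm u) (norm_nonneg u)]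
    calc _ = c * ((Real.sqrt ‖u‖ * Real.sqrt ‖𝔸.incl u‖) *
          (Real.sqrt ‖v‖ * Real.sqrt ‖𝔸.incl v‖)) := by ring
      _ ≤ c * ((Real.sqrt ‖𝔸.incl‖ * ‖u‖) * (Real.sqrt ‖𝔸.incl‖ * ‖v‖)) := by
          have := e u
          have := e v
          gcongr
      _ = c * (Real.sqrt ‖𝔸.incl‖ * Real.sqrt ‖𝔸.incl‖) * ‖u‖ * ‖v‖ := by ring
      _ = _ := by rw [Real.mul_self_sqrt (norm_nonneg _)]

theorem BilinearAssumption.continuous_diag {B : 𝔸.V →ₗ[ℝ] 𝔸.V →ₗ[ℝ] 𝔸.Vdual}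
    (hB : BilinearAssumption 𝔸 B) : Continuous fun u => B u u := by
  obtain ⟨c, hc, -, -, hb⟩ := hB.exists_const
  let B' := LinearMap.mkContinuous₂ B (c * ‖𝔸.incl‖) hb
  have : Continuous fun u => B' u u := B'.continuous.clm_apply continuous_id
  exact this

/-! ### The drift -/

/-- The drift `-A u + f(u) + B(u,u) + σ(u) k`, as an element of `V*`. -/
def drift (f : H → 𝔸.Vdual) (σ : H → H) (B : 𝔸.V →ₗ[ℝ] 𝔸.V →ₗ[ℝ] 𝔸.Vdual) {T : ℝ}
    (k : Ctrl T) (u : XPath 𝔸 T) (s : ℝ) : 𝔸.Vdual :=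
  -𝔸.formA (u.toV s) + f (u.toH s) + B (u.toV s) (u.toV s) + 𝔸.toVdual (k s • σ (u.toH s))

theorem memLp_two_of_continuousOn {E : Type*} [NormedAddCommGroup E] {T : ℝ} {F : ℝ → E}
    (hF : ContinuousOn F (Icc 0 T)) : MemLp F 2 (volume.restrict (Icc 0 T)) := by
  obtain ⟨M, hM⟩ := isCompact_Icc.exists_bound_of_continuousOn hF
  have : IsFiniteMeasure (volume.restrict (Icc 0 T)) := ⟨by simp⟩
  exact MemLp.of_bound (hF.aestronglyMeasurable_of_isCompact isCompact_Icc measurableSet_Icc)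
    M ((ae_restrict_iff' measurableSet_Icc).2 (Eventually.of_forall hM))

variable {f : H → 𝔸.Vdual} {σ : H → H} {B : 𝔸.V →ₗ[ℝ] 𝔸.V →ₗ[ℝ] 𝔸.Vdual} {T : ℝ}

theorem memLp_formA (u : XPath 𝔸 T) :
    MemLp (fun s => 𝔸.formA (u.toV s)) 2 (volume.restrict (Icc 0 T)) :=
  𝔸.formA.comp_memLp' u.memLp_toV

theorem memLp_f (hfσ : LipschitzCoeff 𝔸 f σ) (u : XPath 𝔸 T) :
    MemLp (fun s => f (u.toH s)) 2 (volume.restrict (Icc 0 T)) :=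
  memLp_two_of_continuousOn (hfσ.continuous_f.comp_continuousOn u.continuousOn_toH)

/-- A path is bounded in H and square integrable in V, so the product ‖u‖ |u| is square integrable
in time. This puts the drift in L²(V*), as the energy equality requires. -/
theorem memLp_B (hB : BilinearAssumption 𝔸 B) (u : XPath 𝔸 T) :
    MemLp (fun s => B (u.toV s) (u.toV s)) 2 (volume.restrict (Icc 0 T)) := by
  obtain ⟨c, hc, -, hb, -⟩ := hB.exists_const
  obtain ⟨M, hM⟩ := isCompact_Icc.exists_bound_of_continuousOn u.continuousOn_toH
  refine u.memLp_toV.of_le_mul (c := c * M)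
    (hB.continuous_diag.comp_aestronglyMeasurable u.memLp_toV.1) ?_
  filter_upwards [u.ae_eq, ae_restrict_mem measurableSet_Icc] with s h1 hs
  have h2 := hb (u.toV s)
  rw [h1] at h2
  calc _ ≤ c * ‖u.toV s‖ * ‖u.toH s‖ := h2
    _ ≤ c * ‖u.toV s‖ * M := mul_le_mul_of_nonneg_left (hM s hs) (by positivity)
    _ = _ := by ring

omit [CompleteSpace H] in
theorem memLp_smul_of_continuousOn (k : Ctrl T) {F : ℝ → H} (hF : ContinuousOn F (Icc 0 T)) :
    MemLp (fun s => k s • F s) 2 (volume.restrict (Icc 0 T)) := by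
  obtain ⟨M, hM⟩ := isCompact_Icc.exists_bound_of_continuousOn hF
  refine (Lp.memLp k).of_le_mul (c := M) ((Lp.memLp k).1.smul
    (hF.aestronglyMeasurable_of_isCompact isCompact_Icc measurableSet_Icc)) ?_
  filter_upwards [ae_restrict_mem measurableSet_Icc] with s hs
  rw [norm_smul, mul_comm]
  exact mul_le_mul_of_nonneg_right (hM s hs) (norm_nonneg _)

theorem memLp_σ (hfσ : LipschitzCoeff 𝔸 f σ) (k : Ctrl T) (u : XPath 𝔸 T) :
    MemLp (fun s => 𝔸.toVdual (k s • σ (u.toH s))) 2 (volume.restrict (Icc 0 T)) :=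
  𝔸.toVdual.comp_memLp' (memLp_smul_of_continuousOn k
    (hfσ.continuous_σ.comp_continuousOn u.continuousOn_toH))

theorem memLp_drift (hfσ : LipschitzCoeff 𝔸 f σ) (hB : BilinearAssumption 𝔸 B) (k : Ctrl T)
    (u : XPath 𝔸 T) : MemLp (drift f σ B k u) 2 (volume.restrict (Icc 0 T)) :=
  (((memLp_formA u).neg.add (memLp_f hfσ u)).add (memLp_B hB u)).add (memLp_σ hfσ k u)

theorem intervalIntegrable_of_memLp {E : Type*} [NormedAddCommGroup E] {F : ℝ → E}
    (hF : MemLp F 2 (volume.restrict (Icc 0 T))) {s t : ℝ} (hs : s ∈ Icc 0 T) (ht : t ∈ Icc 0 T) :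
    IntervalIntegrable F volume s t := by
  have : IsFiniteMeasure (volume.restrict (Icc 0 T)) := ⟨by simp⟩
  have h : IntegrableOn F (Icc 0 T) volume := hF.integrable (by norm_num)
  exact (h.mono_set (uIcc_subset_Icc hs ht)).intervalIntegrable

theorem driftIntegral_eq (hfσ : LipschitzCoeff 𝔸 f σ) (hB : BilinearAssumption 𝔸 B) (k : Ctrl T)
    (u : XPath 𝔸 T) {t : ℝ} (ht : t ∈ Icc 0 T) :
    driftIntegral 𝔸 f σ B k u t = ∫ s in (0 : ℝ)..t, drift f σ B k u s := by
  have h0 : (0 : ℝ) ∈ Icc 0 T := ⟨le_rfl, ht.1.trans ht.2⟩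
  have i1 := intervalIntegrable_of_memLp (memLp_formA u) h0 ht
  have i1' : IntervalIntegrable (fun s => -𝔸.formA (u.toV s)) volume 0 t := i1.neg
  have i2 := intervalIntegrable_of_memLp (memLp_f hfσ u) h0 ht
  have i3 := intervalIntegrable_of_memLp (memLp_B hB u) h0 ht
  have i4 := intervalIntegrable_of_memLp (memLp_σ hfσ k u) h0 ht
  simp only [driftIntegral, drift]
  rw [intervalIntegral.integral_add ((i1'.add i2).add i3) i4,
    intervalIntegral.integral_add (i1'.add i2) i3, intervalIntegral.integral_add i1' i2,
    intervalIntegral.integral_neg]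

theorem drift_apply (f : H → 𝔸.Vdual) (σ : H → H) (B : 𝔸.V →ₗ[ℝ] 𝔸.V →ₗ[ℝ] 𝔸.Vdual) (k : Ctrl T)
    (u : XPath 𝔸 T) (s : ℝ) (v : 𝔸.V) :
    drift f σ B k u s v = -⟪u.toV s, v⟫_ℝ + f (u.toH s) v + B (u.toV s) (u.toV s) v +
      k s * ⟪σ (u.toH s), 𝔸.incl v⟫_ℝ := by
  simp only [drift, add_apply, neg_apply, CoerciveOperator.toVdual_apply, real_inner_smul_left]
  rfl

end

section

variable {H : Type*} [NormedAddCommGroup H] [InnerProductSpace ℝ H] [CompleteSpace H]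
  {𝔸 : CoerciveOperator H} {f : H → 𝔸.Vdual} {σ : H → H}
  {B : 𝔸.V →ₗ[ℝ] 𝔸.V →ₗ[ℝ] 𝔸.Vdual} {T N : ℝ} {u₀ : H}

/-! ### A priori estimates -/

theorem Icc_zero_mono {t : ℝ} (ht : t ∈ Icc 0 T) :
    volume.restrict (Icc 0 t) ≤ volume.restrict (Icc 0 T) :=
  Measure.restrict_mono (Icc_subset_Icc le_rfl ht.2) le_rfl

theorem ctrl_intervalIntegrable_sq (k : Ctrl T) {s t : ℝ} (hs : s ∈ Icc 0 T) (ht : t ∈ Icc 0 T) :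
    IntervalIntegrable (fun r => (k r) ^ 2) volume s t :=
  (IntegrableOn.mono_set (Lp.memLp k).integrable_sq (uIcc_subset_Icc hs ht)).intervalIntegrable

theorem ctrl_intervalIntegrable_abs (k : Ctrl T) {s t : ℝ} (hs : s ∈ Icc 0 T)
    (ht : t ∈ Icc 0 T) : IntervalIntegrable (fun r => |k r|) volume s t :=
  (intervalIntegrable_of_memLp (Lp.memLp k) hs ht).abs

/-- Young's inequality for controls in the ball. -/
theorem integral_abs_ctrl_le {k : Ctrl T} (hk : k ∈ ctrlBall T N) {s t l : ℝ} (hl : 0 < l)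
    (hs : 0 ≤ s) (hst : s ≤ t) (ht : t ≤ T) :
    ∫ r in s..t, |k r| ≤ l / 2 * (t - s) + N / (2 * l) := by
  have ms : s ∈ Icc 0 T := ⟨hs, hst.trans ht⟩
  have mt : t ∈ Icc 0 T := ⟨hs.trans hst, ht⟩
  have i2 := ctrl_intervalIntegrable_sq k ms mt
  have h1 : ∫ r in s..t, (k r) ^ 2 ≤ N := by
    rw [intervalIntegral.integral_of_le hst]
    exact (setIntegral_mono_set (Lp.memLp k).integrable_sq
      (Eventually.of_forall fun r => sq_nonneg (k r))
      (Ioc_subset_Icc_self.trans (Icc_subset_Icc hs ht)).eventuallyLE).trans hk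
  -- The weight l stays free: l = 1 serves the Grönwall bounds, l = √n the distance to the ball.
  calc ∫ r in s..t, |k r| ≤ ∫ r in s..t, (l / 2 + (2 * l)⁻¹ * (k r) ^ 2) := by
        refine intervalIntegral.integral_mono_on hst (ctrl_intervalIntegrable_abs k ms mt)
          (IntervalIntegrable.add (by simp) (i2.const_mul _)) fun r _ => ?_
        rw [← sq_abs (k r)]
        have : l / 2 + (2 * l)⁻¹ * |k r| ^ 2 - |k r| = (2 * l)⁻¹ * (l - |k r|) ^ 2 := by
          field_simp; ring
        have : 0 ≤ (2 * l)⁻¹ * (l - |k r|) ^ 2 := by positivity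
        linarith
    _ = l / 2 * (t - s) + (2 * l)⁻¹ * ∫ r in s..t, (k r) ^ 2 := by
        rw [intervalIntegral.integral_add (by simp) (i2.const_mul _),
          intervalIntegral.integral_const, intervalIntegral.integral_const_mul, smul_eq_mul]
        ring
    _ ≤ l / 2 * (t - s) + N / (2 * l) := by
        rw [div_eq_inv_mul N]
        have : (0 : ℝ) ≤ (2 * l)⁻¹ := by positivity
        linarith [mul_le_mul_of_nonneg_left h1 this]

/-- The B term vanishes by skew-symmetry. Young's inequality absorbs the f term into half of -2‖u‖²,
leaving -‖u‖²; the σ term is bounded by growth alone. -/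
theorem two_mul_drift_self_le {C : ℝ} (hC : 0 ≤ C) (hf : ∀ u, ‖f u‖ ≤ C * (1 + ‖u‖))
    (hσ : ∀ u, ‖σ u‖ ≤ C * (1 + ‖u‖)) (hB : BilinearAssumption 𝔸 B) (k : Ctrl T) (u : XPath 𝔸 T)
    {s : ℝ} (hs : 𝔸.incl (u.toV s) = u.toH s) :
    2 * drift f σ B k u s (u.toV s) ≤
      -‖u.toV s‖ ^ 2 + (2 * C ^ 2 + 4 * C) * (1 + |k s|) * (1 + ‖u.toH s‖ ^ 2) := by
  rw [drift_apply, hB.apply_self, hs, real_inner_self_eq_norm_sq]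
  have h1 : f (u.toH s) (u.toV s) ≤ C * (1 + ‖u.toH s‖) * ‖u.toV s‖ :=
    (le_abs_self _).trans (((f (u.toH s)).le_opNorm _).trans
      (mul_le_mul_of_nonneg_right (hf _) (norm_nonneg _)))
  have h2 : k s * ⟪σ (u.toH s), u.toH s⟫_ℝ ≤ |k s| * (C * (1 + ‖u.toH s‖) * ‖u.toH s‖) := by
    refine (le_abs_self _).trans ?_
    rw [abs_mul]
    exact mul_le_mul_of_nonneg_left ((abs_real_inner_le_norm _ _).trans
      (mul_le_mul_of_nonneg_right (hσ _) (norm_nonneg _))) (abs_nonneg _)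
  set x := ‖u.toH s‖
  set y := ‖u.toV s‖
  set κ := |k s|
  have hκ : 0 ≤ κ := abs_nonneg _
  have h3 : 2 * (C * (1 + x) * y) ≤ y ^ 2 + 2 * C ^ 2 * (1 + x ^ 2) := by
    nlinarith [sq_nonneg (C * (1 + x) - y), mul_nonneg (sq_nonneg C) (sq_nonneg (1 - x))]
  have h4 : C * (1 + x) * x ≤ 2 * C * (1 + x ^ 2) := by
    nlinarith [mul_nonneg hC (sq_nonneg (1 - x)), mul_nonneg hC (sq_nonneg x)]
  have h5 := mul_le_mul_of_nonneg_left h4 hκ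
  have h6 : 0 ≤ C * (1 + x ^ 2) := by positivity
  have h7 : 0 ≤ C ^ 2 * κ * (1 + x ^ 2) := by positivity
  nlinarith

/-- The right hand side of the penalized equation. -/
def penalizedDrift (f : H → 𝔸.Vdual) (σ : H → H) (B : 𝔸.V →ₗ[ℝ] 𝔸.V →ₗ[ℝ] 𝔸.Vdual) (n : ℕ)
    (k : Ctrl T) (u : XPath 𝔸 T) (s : ℝ) : 𝔸.Vdual :=
  drift f σ B k u s - (n : ℝ) • 𝔸.toVdual (u.toH s - ballProj (u.toH s))

theorem memLp_penalization (u : XPath 𝔸 T) :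
    MemLp (fun s => 𝔸.toVdual (u.toH s - ballProj (u.toH s))) 2 (volume.restrict (Icc 0 T)) :=
  𝔸.toVdual.comp_memLp' (memLp_two_of_continuousOn
    (continuous_sub_ballProj.comp_continuousOn u.continuousOn_toH))

theorem memLp_penalizedDrift (hfσ : LipschitzCoeff 𝔸 f σ) (hB : BilinearAssumption 𝔸 B) (n : ℕ)
    (k : Ctrl T) (u : XPath 𝔸 T) :
    MemLp (penalizedDrift f σ B n k u) 2 (volume.restrict (Icc 0 T)) :=
  (memLp_drift hfσ hB k u).sub ((memLp_penalization u).const_smul (n : ℝ))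

theorem penalizedDrift_apply (n : ℕ) (k : Ctrl T) (u : XPath 𝔸 T) (s : ℝ) (v : 𝔸.V) :
    penalizedDrift f σ B n k u s v = drift f σ B k u s v -
      n * ⟪u.toH s - ballProj (u.toH s), 𝔸.incl v⟫_ℝ := by
  simp only [penalizedDrift, sub_apply, smul_apply, CoerciveOperator.toVdual_apply, smul_eq_mul]

theorem IsPenalizedSolution.equation' (hfσ : LipschitzCoeff 𝔸 f σ) (hB : BilinearAssumption 𝔸 B)
    {n : ℕ} {k : Ctrl T} {u : XPath 𝔸 T} (hu : IsPenalizedSolution 𝔸 f σ B u₀ n k u) {t : ℝ}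
    (ht : t ∈ Icc 0 T) : 𝔸.toVdual (u.toH t) =
      𝔸.toVdual u₀ + ∫ s in (0 : ℝ)..t, penalizedDrift f σ B n k u s := by
  have h0 : (0 : ℝ) ∈ Icc 0 T := ⟨le_rfl, ht.1.trans ht.2⟩
  have e : ∫ s in (0 : ℝ)..t, penalizedDrift f σ B n k u s =
      (∫ s in (0 : ℝ)..t, drift f σ B k u s) -
        ∫ s in (0 : ℝ)..t, (n : ℝ) • 𝔸.toVdual (u.toH s - ballProj (u.toH s)) :=
    intervalIntegral.integral_sub (intervalIntegrable_of_memLp (memLp_drift hfσ hB k u) h0 ht)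
      (intervalIntegrable_of_memLp ((memLp_penalization u).const_smul (n : ℝ)) h0 ht)
  rw [hu.equation t ht, driftIntegral_eq hfσ hB k u ht, e, intervalIntegral.integral_smul]
  abel

theorem intervalIntegrable_pairing {g : ℝ → 𝔸.Vdual} {W : ℝ → 𝔸.V}
    (hg : MemLp g 2 (volume.restrict (Icc 0 T))) (hW : MemLp W 2 (volume.restrict (Icc 0 T)))
    {s t : ℝ} (hs : s ∈ Icc 0 T) (ht : t ∈ Icc 0 T) :
    IntervalIntegrable (fun r => g r (W r)) volume s t :=
  (IntegrableOn.mono_set (integrable_dual_apply hg hW) (uIcc_subset_Icc hs ht)).intervalIntegrable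

/-- Energy equality for the penalized equation. -/
theorem IsPenalizedSolution.energy (hfσ : LipschitzCoeff 𝔸 f σ) (hB : BilinearAssumption 𝔸 B)
    {n : ℕ} {k : Ctrl T} {u : XPath 𝔸 T} (hu : IsPenalizedSolution 𝔸 f σ B u₀ n k u) {t : ℝ}
    (ht : t ∈ Icc 0 T) : ‖u.toH t‖ ^ 2 =
      ‖u₀‖ ^ 2 + 2 * ∫ s in (0 : ℝ)..t, penalizedDrift f σ B n k u s (u.toV s) := by
  rcases eq_or_lt_of_le ht.1 with rfl | ht0
  · rw [intervalIntegral.integral_same, hu.initial]; ring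
  have h := tendsto_energy 𝔸 ht0 (w := u.toH) (L := fun _ => 0)
    (u.continuousOn_toH.mono (Icc_subset_Icc le_rfl ht.2)) continuousOn_const
    ((memLp_penalizedDrift hfσ hB n k u).mono_measure (Icc_zero_mono ht))
    (u.memLp_toV.mono_measure (Icc_zero_mono ht)) (ae_mono (Icc_zero_mono ht) u.ae_eq)
    (fun s hs => by
      rw [hu.equation' hfσ hB ⟨hs.1, hs.2.trans ht.2⟩, hu.initial, map_zero, add_zero])
  have e : averagedStieltjes (fun _ => (0 : H)) u.toH t = fun _ => 0 := by
    ext h; simp [averagedStieltjes]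
  rw [e] at h
  have := tendsto_nhds_unique h tendsto_const_nhds
  rw [hu.initial] at this
  linarith

/-- Energy inequality for the penalized equation. -/
theorem IsPenalizedSolution.energy_le (hfσ : LipschitzCoeff 𝔸 f σ) (hB : BilinearAssumption 𝔸 B)
    {C : ℝ} (hC : 0 ≤ C) (hf : ∀ u, ‖f u‖ ≤ C * (1 + ‖u‖)) (hσ : ∀ u, ‖σ u‖ ≤ C * (1 + ‖u‖))
    {n : ℕ} {k : Ctrl T} {u : XPath 𝔸 T} (hu : IsPenalizedSolution 𝔸 f σ B u₀ n k u) {s t : ℝ}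
    (hs : 0 ≤ s) (hst : s ≤ t) (ht : t ≤ T) :
    ‖u.toH t‖ ^ 2 - ‖u.toH s‖ ^ 2 ≤
      (∫ r in s..t, (2 * C ^ 2 + 4 * C) * (1 + |k r|) * (1 + ‖u.toH r‖ ^ 2)) -
        n * ∫ r in s..t, max (‖u.toH r‖ ^ 2 - 1) 0 := by
  have ms : s ∈ Icc 0 T := ⟨hs, hst.trans ht⟩
  have mt : t ∈ Icc 0 T := ⟨hs.trans hst, ht⟩
  have m0 : (0 : ℝ) ∈ Icc 0 T := ⟨le_rfl, mt.1.trans mt.2⟩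
  have hP : ∀ {a b : ℝ}, a ∈ Icc 0 T → b ∈ Icc 0 T → IntervalIntegrable
      (fun r => penalizedDrift f σ B n k u r (u.toV r)) volume a b := fun ha hb =>
    intervalIntegrable_pairing (memLp_penalizedDrift hfσ hB n k u) u.memLp_toV ha hb
  have hc : ContinuousOn (fun r => ‖u.toH r‖ ^ 2) (uIcc s t) :=
    (u.continuousOn_toH.mono (uIcc_subset_Icc ms mt)).norm.pow 2
  have i1 : IntervalIntegrable
      (fun r => (2 * C ^ 2 + 4 * C) * (1 + |k r|) * (1 + ‖u.toH r‖ ^ 2)) volume s t :=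
    (((IntervalIntegrable.add (by simp) (ctrl_intervalIntegrable_abs k ms mt)).const_mul
      _).mul_continuousOn (continuousOn_const.add hc))
  have i2 : IntervalIntegrable (fun r => max (‖u.toH r‖ ^ 2 - 1) 0) volume s t :=
    ((continuous_id.max continuous_const).comp_continuousOn
      (hc.sub continuousOn_const)).intervalIntegrable
  rw [hu.energy hfσ hB mt, hu.energy hfσ hB ms, add_sub_add_left_eq_sub, ← mul_sub,
    intervalIntegral.integral_interval_sub_left (hP m0 mt) (hP m0 ms),
    ← intervalIntegral.integral_const_mul, ← intervalIntegral.integral_const_mul,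
    ← intervalIntegral.integral_sub i1 (i2.const_mul _)]
  refine intervalIntegral.integral_mono_ae_restrict hst ((hP ms mt).const_mul 2)
    (i1.sub (i2.const_mul _)) ?_
  have hsub : volume.restrict (Icc s t) ≤ volume.restrict (Icc 0 T) :=
    Measure.restrict_mono (Icc_subset_Icc hs ht) le_rfl
  filter_upwards [ae_mono hsub u.ae_eq] with r hr
  have h1 := two_mul_drift_self_le hC hf hσ hB k u hr
  have h2 := mul_le_mul_of_nonneg_left (max_le_two_mul_inner_sub_ballProj (u.toH r))
    (Nat.cast_nonneg (α := ℝ) n)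
  simp only [penalizedDrift_apply, hr]
  nlinarith [sq_nonneg ‖u.toV r‖]

theorem integral_one_add_abs_ctrl_le {k : Ctrl T} (hk : k ∈ ctrlBall T N) {s t l : ℝ} (hl : 0 < l)
    (hs : 0 ≤ s) (hst : s ≤ t) (ht : t ≤ T) {D : ℝ} (hD : 0 ≤ D) :
    ∫ r in s..t, D * (1 + |k r|) ≤ D * ((1 + l / 2) * (t - s) + N / (2 * l)) := by
  have ms : s ∈ Icc 0 T := ⟨hs, hst.trans ht⟩
  have mt : t ∈ Icc 0 T := ⟨hs.trans hst, ht⟩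
  rw [intervalIntegral.integral_const_mul, intervalIntegral.integral_add (by simp)
    (ctrl_intervalIntegrable_abs k ms mt), intervalIntegral.integral_const, smul_eq_mul, mul_one]
  refine mul_le_mul_of_nonneg_left ?_ hD
  linarith [integral_abs_ctrl_le hk hl hs hst ht]

/-- The penalized solutions leave the ball by at most `O(n^{-1/2})`, uniformly in the controls. -/
theorem exists_penalized_bound (hfσ : LipschitzCoeff 𝔸 f σ) (hB : BilinearAssumption 𝔸 B)
    (hu₀ : ‖u₀‖ ≤ 1) (hT : 0 < T) (hN : 0 < N) :
    ∃ E : ℝ, 0 ≤ E ∧ ∀ (n : ℕ), 1 ≤ n → ∀ k ∈ ctrlBall T N, ∀ u : XPath 𝔸 T,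
      IsPenalizedSolution 𝔸 f σ B u₀ n k u → ∀ t ∈ Icc 0 T,
        ‖u.toH t‖ ^ 2 ≤ 1 + E / Real.sqrt n := by
  obtain ⟨C, hC, -, -, hf, hσ⟩ := hfσ.exists_const
  set D := 2 * C ^ 2 + 4 * C with hD
  have hD0 : 0 ≤ D := by positivity
  obtain ⟨G, hG0, hG⟩ := exists_gronwall_const (D * ((1 + 1 / 2) * (T - 0) + N / (2 * 1)))
  refine ⟨D * (1 + G * 2) * (3 + N), by positivity, fun n hn k hk u hu t ht => ?_⟩
  have m0 : (0 : ℝ) ∈ Icc 0 T := ⟨le_rfl, hT.le⟩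
  have mT : T ∈ Icc 0 T := ⟨hT.le, le_rfl⟩
  have hu0 : ‖u₀‖ ^ 2 ≤ 1 := pow_le_one₀ (norm_nonneg _) hu₀
  have hψc : ContinuousOn (fun r => 1 + ‖u.toH r‖ ^ 2) (Icc 0 T) :=
    continuousOn_const.add (u.continuousOn_toH.norm.pow 2)
  have hb : ∀ {a b : ℝ}, a ∈ Icc 0 T → b ∈ Icc 0 T →
      IntervalIntegrable (fun r => D * (1 + |k r|)) volume a b := fun ha hb =>
    (IntervalIntegrable.add (by simp) (ctrl_intervalIntegrable_abs k ha hb)).const_mul _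
  -- Here the penalization is dropped by sign, so the Grönwall bound on 1 + |u|² does not depend on
  -- `n`; the 2 bounds its initial value.
  have hbound : ∀ s ∈ Icc 0 T, 1 + ‖u.toH s‖ ^ 2 ≤ G * 2 := by
    refine hG T 2 (fun r => D * (1 + |k r|)) (fun r => 1 + ‖u.toH r‖ ^ 2) hT.le (by norm_num)
      (hb m0 mT) (fun r _ => by positivity) hψc (fun r _ => by positivity) (fun s hs => ?_)
      (integral_one_add_abs_ctrl_le hk one_pos le_rfl hT.le le_rfl hD0)
    have h1 := hu.energy_le hfσ hB hC hf hσ le_rfl hs.1 hs.2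
    rw [hu.initial] at h1
    have h2 : 0 ≤ (n : ℝ) * ∫ r in (0 : ℝ)..s, max (‖u.toH r‖ ^ 2 - 1) 0 :=
      mul_nonneg (Nat.cast_nonneg _)
        (intervalIntegral.integral_nonneg hs.1 fun r _ => le_max_right _ _)
    linarith
  have hn0 : (1 : ℝ) ≤ n := by exact_mod_cast hn
  set q := Real.sqrt n with hq
  have hq1 : 1 ≤ q := Real.one_le_sqrt.2 hn0
  have hqq : q * q = n := Real.mul_self_sqrt (by linarith)
  have hq0 : 0 < q := by linarith
  have hM : 0 ≤ D * (1 + G * 2) := by positivity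
  -- Young's inequality with weight q = √n makes α of order √n and β of order 1/√n, so α/n and β are
  -- both of order n^{-1/2}.
  have key := le_of_restoring_drift (z := fun r => ‖u.toH r‖ ^ 2 - 1) (T := T) (n := n)
    (α := D * (1 + G * 2) * (1 + q / 2)) (β := D * (1 + G * 2) * (N / (2 * q)))
    (by linarith) (by positivity) (by positivity)
    ((u.continuousOn_toH.norm.pow 2).sub continuousOn_const)
    (by rw [hu.initial]; linarith)
    (fun s t hs hst ht => by
      have h1 := hu.energy_le hfσ hB hC hf hσ hs hst ht
      have ms : s ∈ Icc 0 T := ⟨hs, hst.trans ht⟩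
      have mt : t ∈ Icc 0 T := ⟨hs.trans hst, ht⟩
      have h2 := integral_mul_le_of_le (y := fun r => 1 + ‖u.toH r‖ ^ 2) (M := G * 2) hst
        (hb ms mt) (fun r _ => by positivity) (hψc.mono (Icc_subset_Icc hs ht))
        (fun r hr => hbound r ⟨hs.trans hr.1, hr.2.trans ht⟩)
      have h3 := integral_one_add_abs_ctrl_le hk hq0 hs hst ht hD0
      have h4 : G * 2 * (∫ r in s..t, D * (1 + |k r|)) ≤
          (1 + G * 2) * (D * ((1 + q / 2) * (t - s) + N / (2 * q))) := by
        have h5 : 0 ≤ D * ((1 + q / 2) * (t - s) + N / (2 * q)) :=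
          mul_nonneg hD0 (add_nonneg (mul_nonneg (by linarith) (by linarith)) (by positivity))
        have := mul_le_mul_of_nonneg_left h3 (show 0 ≤ G * 2 by positivity)
        linarith
      linarith) t ht
  have h1 : 2 * (D * (1 + G * 2) * (1 + q / 2) / n + D * (1 + G * 2) * (N / (2 * q))) =
      D * (1 + G * 2) * (2 / q + 1 + N) / q := by
    rw [← hqq]; field_simp
  have h2 : D * (1 + G * 2) * (2 / q + 1 + N) / q ≤ D * (1 + G * 2) * (3 + N) / q := by
    refine div_le_div_of_nonneg_right (mul_le_mul_of_nonneg_left ?_ hM) hq0.le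
    have : 2 / q ≤ 2 := div_le_self (by norm_num) hq1
    linarith
  linarith

end

section

variable {H : Type*} [NormedAddCommGroup H] [InnerProductSpace ℝ H] [CompleteSpace H]
  {𝔸 : CoerciveOperator H} {f : H → 𝔸.Vdual} {σ : H → H}
  {B : 𝔸.V →ₗ[ℝ] 𝔸.V →ₗ[ℝ] 𝔸.Vdual} {T N : ℝ} {u₀ : H}

/-! ### The reflected equation -/

theorem intervalIntegrable_norm_sq {E : Type*} [NormedAddCommGroup E] {W : ℝ → E}
    (hW : MemLp W 2 (volume.restrict (Icc 0 T))) {s t : ℝ} (hs : s ∈ Icc 0 T) (ht : t ∈ Icc 0 T) :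
    IntervalIntegrable (fun r => ‖W r‖ ^ 2) volume s t :=
  (IntegrableOn.mono_set (hW.norm.integrable_sq) (uIcc_subset_Icc hs ht)).intervalIntegrable

theorem IsReflectedSolution.stieltjesNonneg {k : Ctrl T} {u : XPath 𝔸 T} {L : ℝ → H}
    (hu : IsReflectedSolution 𝔸 f σ B u₀ k u L) {t : ℝ} (ht : t ∈ Icc 0 T) {v : ℝ → H}
    (hv : ContinuousOn v (Icc 0 T)) (hv1 : ∀ s ∈ Icc 0 T, ‖v s‖ ≤ 1) :
    StieltjesNonneg (fun s => v s - u.toH s) L t :=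
  stieltjesNonneg_of_reflection ht u.continuousOn_toH hu.mem_ball hv hv1 hu.continuousOn_L
    hu.boundedVariation_L hu.reflection

theorem IsReflectedSolution.equation' (hfσ : LipschitzCoeff 𝔸 f σ) (hB : BilinearAssumption 𝔸 B)
    {k : Ctrl T} {u : XPath 𝔸 T} {L : ℝ → H} (hu : IsReflectedSolution 𝔸 f σ B u₀ k u L) {t : ℝ}
    (ht : t ∈ Icc 0 T) : 𝔸.toVdual (u.toH t) =
      𝔸.toVdual u₀ + (∫ s in (0 : ℝ)..t, drift f σ B k u s) + 𝔸.toVdual (L t) := by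
  rw [hu.equation t ht, driftIntegral_eq hfσ hB k u ht]

/-- Energy equality for the reflected equation. -/
theorem IsReflectedSolution.tendsto_energy (hfσ : LipschitzCoeff 𝔸 f σ)
    (hB : BilinearAssumption 𝔸 B) {k : Ctrl T} {u : XPath 𝔸 T} {L : ℝ → H}
    (hu : IsReflectedSolution 𝔸 f σ B u₀ k u L) {t : ℝ} (ht : t ∈ Ioc 0 T) :
    Tendsto (averagedStieltjes L u.toH t) (𝓝[>] 0) (𝓝 (‖u.toH t‖ ^ 2 - ‖u₀‖ ^ 2 -
      2 * ∫ s in (0 : ℝ)..t, drift f σ B k u s (u.toV s))) := by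
  have ht' : t ∈ Icc 0 T := Ioc_subset_Icc_self ht
  have h := ReflectedSEE.tendsto_energy 𝔸 ht.1 (w := u.toH) (L := L)
    (u.continuousOn_toH.mono (Icc_subset_Icc le_rfl ht.2))
    (hu.continuousOn_L.mono (Icc_subset_Icc le_rfl ht.2))
    ((memLp_drift hfσ hB k u).mono_measure (Icc_zero_mono ht'))
    (u.memLp_toV.mono_measure (Icc_zero_mono ht')) (ae_mono (Icc_zero_mono ht') u.ae_eq)
    (fun s hs => by rw [hu.equation' hfσ hB ⟨hs.1, hs.2.trans ht.2⟩, hu.initial])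
  rwa [hu.initial] at h

/-- Uniform bounds for the reflected equation: for the `L²(0,T;V)` norm and for `-∫₀ᵗ (u, dL)`. -/
theorem exists_reflected_bound (hfσ : LipschitzCoeff 𝔸 f σ) (hB : BilinearAssumption 𝔸 B)
    (hu₀ : ‖u₀‖ ≤ 1) (hN : 0 < N) :
    ∃ E : ℝ, 0 ≤ E ∧ ∀ k ∈ ctrlBall T N, ∀ (u : XPath 𝔸 T) (L : ℝ → H),
      IsReflectedSolution 𝔸 f σ B u₀ k u L → ∀ t ∈ Ioc 0 T,
        ∫ s in (0 : ℝ)..t, ‖u.toV s‖ ^ 2 ≤ E ∧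
        -E ≤ ‖u.toH t‖ ^ 2 - ‖u₀‖ ^ 2 -
          2 * ∫ s in (0 : ℝ)..t, drift f σ B k u s (u.toV s) := by
  obtain ⟨C, hC, -, -, hf, hσ⟩ := hfσ.exists_const
  set D := 2 * C ^ 2 + 4 * C with hD
  have hD0 : 0 ≤ D := by positivity
  rcases le_or_gt T 0 with hT | hT
  · exact ⟨0, le_rfl, fun k _ u L _ t ht => absurd (ht.1.trans_le ht.2) (not_lt.2 hT)⟩
  refine ⟨1 + 2 * D * ((1 + 1 / 2) * T + N / (2 * 1)), by positivity,
    fun k hk u L hu t ht => ?_⟩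
  have m0 : (0 : ℝ) ∈ Icc 0 T := ⟨le_rfl, hT.le⟩
  have ht' : t ∈ Icc 0 T := Ioc_subset_Icc_self ht
  have hu0 : ‖u₀‖ ^ 2 ≤ 1 := pow_le_one₀ (norm_nonneg _) hu₀
  have hE := hu.tendsto_energy hfσ hB ht
  set c := ‖u.toH t‖ ^ 2 - ‖u₀‖ ^ 2 - 2 * ∫ s in (0 : ℝ)..t, drift f σ B k u s (u.toV s) with hc
  have huc : ContinuousOn u.toH (Icc 0 t) :=
    u.continuousOn_toH.mono (Icc_subset_Icc le_rfl ht.2)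
  have hLc : ContinuousOn L (Icc 0 t) := hu.continuousOn_L.mono (Icc_subset_Icc le_rfl ht.2)
  -- The test path φ = 0 gives ∫ (-u, dL) ≥ 0, and c stands for 2 ∫ (u, dL); hence c ≤ 0. The zero
  -- multiple is there to fit the two-term linearity of the averages.
  have hsign : 0 ≤ -1 * c + 0 * c := by
    refine tendsto_averagedStieltjes_nonneg ht.1 (p := fun s => (-1 : ℝ) • u.toH s +
      (0 : ℝ) • u.toH s) ((huc.const_smul _).add (huc.const_smul _)) hLc ?_ ?_
    · have := hu.stieltjesNonneg ht' (v := fun _ => 0) continuousOn_const (by simp)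
      simpa using this
    · refine ((hE.const_mul (-1)).add (hE.const_mul 0)).congr' ?_
      filter_upwards [Ioo_mem_nhdsGT ht.1] with h hh
      rw [averagedStieltjes_linear hh hLc huc huc]
  have i1 := intervalIntegrable_norm_sq u.memLp_toV m0 ht'
  have i2 : IntervalIntegrable (fun r => 2 * (D * (1 + |k r|))) volume 0 t :=
    ((IntervalIntegrable.add (by simp) (ctrl_intervalIntegrable_abs k m0 ht')).const_mul _).const_mul
      _
  have i3 := intervalIntegrable_pairing (memLp_drift hfσ hB k u) u.memLp_toV m0 ht'
  have hle : ∫ s in (0 : ℝ)..t, 2 * drift f σ B k u s (u.toV s) ≤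
      ∫ s in (0 : ℝ)..t, (2 * (D * (1 + |k s|)) - ‖u.toV s‖ ^ 2) := by
    refine intervalIntegral.integral_mono_ae_restrict ht.1.le (i3.const_mul 2) (i2.sub i1) ?_
    filter_upwards [ae_mono (Icc_zero_mono ht') u.ae_eq, ae_restrict_mem measurableSet_Icc]
      with s hs hst
    have h1 := two_mul_drift_self_le hC hf hσ hB k u hs
    have h2 : ‖u.toH s‖ ^ 2 ≤ 1 :=
      pow_le_one₀ (norm_nonneg _) (hu.mem_ball s ⟨hst.1, hst.2.trans ht.2⟩)
    have h3 : D * (1 + |k s|) * (1 + ‖u.toH s‖ ^ 2) ≤ D * (1 + |k s|) * 2 :=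
      mul_le_mul_of_nonneg_left (by linarith) (by positivity)
    linarith
  rw [intervalIntegral.integral_const_mul, intervalIntegral.integral_sub i2 i1,
    intervalIntegral.integral_const_mul] at hle
  have hk1 := integral_one_add_abs_ctrl_le hk one_pos le_rfl ht.1.le ht.2 hD0
  have hk2 : D * ((1 + 1 / 2) * (t - 0) + N / (2 * 1)) ≤
      D * ((1 + 1 / 2) * T + N / (2 * 1)) :=
    mul_le_mul_of_nonneg_left (by linarith [ht.2]) hD0
  have hV : 0 ≤ ∫ s in (0 : ℝ)..t, ‖u.toV s‖ ^ 2 :=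
    intervalIntegral.integral_nonneg ht.1.le fun _ _ => sq_nonneg _
  have hut := sq_nonneg ‖u.toH t‖
  constructor <;> linarith

/-! ### Comparison of the two equations -/

/-- The energy inequality for the difference of the solutions. -/
theorem energy_diff_le (hfσ : LipschitzCoeff 𝔸 f σ) (hB : BilinearAssumption 𝔸 B) {n : ℕ}
    {k : Ctrl T} {u v : XPath 𝔸 T} {L : ℝ → H} (hu : IsPenalizedSolution 𝔸 f σ B u₀ n k u)
    (hv : IsReflectedSolution 𝔸 f σ B u₀ k v L) {ε E : ℝ} (hε : 0 ≤ ε)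
    (hball : ∀ t ∈ Icc 0 T, ‖u.toH t‖ ^ 2 ≤ 1 + ε) {t : ℝ} (ht : t ∈ Ioc 0 T)
    (hE : -E ≤ ‖v.toH t‖ ^ 2 - ‖u₀‖ ^ 2 - 2 * ∫ s in (0 : ℝ)..t, drift f σ B k v s (v.toV s)) :
    ‖u.toH t - v.toH t‖ ^ 2 ≤ ε * E + 2 * ∫ s in (0 : ℝ)..t,
      (penalizedDrift f σ B n k u s - drift f σ B k v s) (u.toV s - v.toV s) := by
  have ht' : t ∈ Icc 0 T := Ioc_subset_Icc_self ht
  have hsub : Icc 0 t ⊆ Icc 0 T := Icc_subset_Icc le_rfl ht.2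
  have m0 : (0 : ℝ) ∈ Icc 0 T := hsub ⟨le_rfl, ht.1.le⟩
  have huc := u.continuousOn_toH.mono hsub
  have hvc := v.continuousOn_toH.mono hsub
  have hLc := hv.continuousOn_L.mono hsub
  have hg := (memLp_penalizedDrift hfσ hB n k u).sub (memLp_drift hfσ hB k v)
  have h1 := ReflectedSEE.tendsto_energy 𝔸 ht.1 (w := fun s => u.toH s - v.toH s)
    (L := fun s => -L s) (huc.sub hvc) hLc.neg (hg.mono_measure (Icc_zero_mono ht'))
    (W := fun s => u.toV s - v.toV s)
    ((u.memLp_toV.sub v.memLp_toV).mono_measure (Icc_zero_mono ht'))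
    (by
      filter_upwards [ae_mono (Icc_zero_mono ht') u.ae_eq, ae_mono (Icc_zero_mono ht') v.ae_eq]
        with s hs1 hs2
      rw [map_sub, hs1, hs2])
    (fun s hs => by
      have e : ∫ r in (0 : ℝ)..s, (penalizedDrift f σ B n k u - drift f σ B k v) r =
          (∫ r in (0 : ℝ)..s, penalizedDrift f σ B n k u r) -
            ∫ r in (0 : ℝ)..s, drift f σ B k v r :=
        intervalIntegral.integral_sub
          (intervalIntegrable_of_memLp (memLp_penalizedDrift hfσ hB n k u) m0 (hsub hs))
          (intervalIntegrable_of_memLp (memLp_drift hfσ hB k v) m0 (hsub hs))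
      rw [e, map_sub, hu.equation' hfσ hB (hsub hs), hv.equation' hfσ hB (hsub hs), hu.initial,
        hv.initial, sub_self, map_zero, map_neg]
      abel)
  have h2 := hv.tendsto_energy hfσ hB ht
  have h3 : averagedStieltjes (fun s => -L s) (fun s => u.toH s - v.toH s) t =
      fun h => -averagedStieltjes L (fun s => u.toH s - v.toH s) t h := by
    ext h
    simp only [averagedStieltjes]
    rw [← mul_neg, ← intervalIntegral.integral_neg]
    congr 2
    ext s
    rw [← inner_neg_left]
    congr 1
    abel
  rw [h3] at h1
  set c := ‖v.toH t‖ ^ 2 - ‖u₀‖ ^ 2 - 2 * ∫ s in (0 : ℝ)..t, drift f σ B k v s (v.toV s) with hc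
  -- Reflection tested with u/(1+ε), which is in the ball because 1 + ε ≤ (1+ε)². Its difference
  -- from v is (1+ε)⁻¹((u - v) - εv), a combination of the two paths for which the energy equality
  -- already supplies limits.
  have hsign : 0 ≤ (1 + ε)⁻¹ * -(‖u.toH t - v.toH t‖ ^ 2 - ‖u.toH 0 - v.toH 0‖ ^ 2 -
      2 * ∫ s in (0 : ℝ)..t, (penalizedDrift f σ B n k u - drift f σ B k v) s
        (u.toV s - v.toV s)) + -((1 + ε)⁻¹ * ε) * c := by
    have hp1 : (1 + ε)⁻¹ * (1 + ε) = 1 := inv_mul_cancel₀ (by positivity)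
    refine tendsto_averagedStieltjes_nonneg ht.1 (p := fun s => (1 + ε)⁻¹ • (u.toH s - v.toH s) +
      (-((1 + ε)⁻¹ * ε)) • v.toH s) (((huc.sub hvc).const_smul _).add (hvc.const_smul _)) hLc ?_ ?_
    · have h4 := hv.stieltjesNonneg ht' (v := fun s => (1 + ε)⁻¹ • u.toH s)
        (u.continuousOn_toH.const_smul _) (fun s hs => by
          rw [norm_smul, Real.norm_of_nonneg (by positivity), inv_mul_le_iff₀ (by positivity),
            mul_one]
          refine le_of_sq_le_sq ((hball s hs).trans ?_) (by positivity)
          nlinarith)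
      have e : ∀ s, (1 + ε)⁻¹ • u.toH s - v.toH s = (1 + ε)⁻¹ • (u.toH s - v.toH s) +
          (-((1 + ε)⁻¹ * ε)) • v.toH s := fun s => by
        have e1 : v.toH s = ((1 + ε)⁻¹ * (1 + ε)) • v.toH s := by rw [hp1, one_smul]
        conv_lhs => rw [e1]
        module
      simp_rw [e] at h4
      exact h4
    · refine ((h1.neg.const_mul _).add (h2.const_mul _)).congr' ?_
      filter_upwards [Ioo_mem_nhdsGT ht.1] with h hh
      rw [averagedStieltjes_linear (x := fun s => u.toH s - v.toH s) hh hLc (huc.sub hvc) hvc,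
        neg_neg]
  rw [hu.initial, hv.initial, sub_self, norm_zero] at hsign
  have h5 : 0 ≤ (1 + ε) * ((1 + ε)⁻¹ * -(‖u.toH t - v.toH t‖ ^ 2 - 0 ^ 2 -
      2 * ∫ s in (0 : ℝ)..t, (penalizedDrift f σ B n k u - drift f σ B k v) s
        (u.toV s - v.toV s)) + -((1 + ε)⁻¹ * ε) * c) := mul_nonneg (by positivity) hsign
  have h6 : ∀ a b : ℝ, (1 + ε) * ((1 + ε)⁻¹ * a + -((1 + ε)⁻¹ * ε) * b) = a - ε * b := by
    intro a b
    have : 1 + ε ≠ 0 := by positivity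
    field_simp
    ring
  rw [h6] at h5
  have h7 := mul_le_mul_of_nonneg_left hE hε
  simp only [Pi.sub_apply] at h5
  linarith

/-- Of the dissipation -2‖u - v‖², Young's inequality gives one quarter to the f term and one
quarter to the B term. The penalization has a good sign since v is in the ball. -/
theorem two_mul_drift_diff_le {C c : ℝ}
    (hf : ∀ u v : H, ‖f u - f v‖ ≤ C * ‖u - v‖) (hσ : ∀ u v : H, ‖σ u - σ v‖ ≤ C * ‖u - v‖)
    (hB : BilinearAssumption 𝔸 B) (hc : ∀ u v, |B u v u| ≤ c * ‖u‖ * ‖𝔸.incl u‖ * ‖v‖)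
    (n : ℕ) (k : Ctrl T) (u v : XPath 𝔸 T) {s : ℝ} (hu : 𝔸.incl (u.toV s) = u.toH s)
    (hv : 𝔸.incl (v.toV s) = v.toH s) (hv1 : ‖v.toH s‖ ≤ 1) :
    2 * (penalizedDrift f σ B n k u s - drift f σ B k v s) (u.toV s - v.toV s) ≤
      -‖u.toV s - v.toV s‖ ^ 2 + (2 * C ^ 2 + 2 * c ^ 2 * ‖v.toV s‖ ^ 2 + 2 * C * |k s|) *
        ‖u.toH s - v.toH s‖ ^ 2 := by
  have e0 : 𝔸.incl (u.toV s - v.toV s) = u.toH s - v.toH s := by rw [map_sub, hu, hv]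
  rw [sub_apply, penalizedDrift_apply, drift_apply, drift_apply, e0]
  have h1 := hB.apply_diff (u.toV s) (v.toV s)
  have h2 := hc (u.toV s - v.toV s) (v.toV s)
  rw [← h1, e0] at h2
  have h3 : ⟪u.toV s, u.toV s - v.toV s⟫_ℝ - ⟪v.toV s, u.toV s - v.toV s⟫_ℝ =
      ‖u.toV s - v.toV s‖ ^ 2 := by
    rw [← inner_sub_left, real_inner_self_eq_norm_sq]
  have h4 : f (u.toH s) (u.toV s - v.toV s) - f (v.toH s) (u.toV s - v.toV s) ≤
      C * ‖u.toH s - v.toH s‖ * ‖u.toV s - v.toV s‖ := by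
    rw [← sub_apply]
    exact (le_abs_self _).trans (((f (u.toH s) - f (v.toH s)).le_opNorm _).trans
      (mul_le_mul_of_nonneg_right (hf _ _) (norm_nonneg _)))
  have h5 : k s * ⟪σ (u.toH s), u.toH s - v.toH s⟫_ℝ - k s * ⟪σ (v.toH s), u.toH s - v.toH s⟫_ℝ ≤
      |k s| * (C * ‖u.toH s - v.toH s‖ * ‖u.toH s - v.toH s‖) := by
    rw [← mul_sub, ← inner_sub_left]
    refine (le_abs_self _).trans ?_
    rw [abs_mul]
    exact mul_le_mul_of_nonneg_left ((abs_real_inner_le_norm _ _).trans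
      (mul_le_mul_of_nonneg_right (hσ _ _) (norm_nonneg _))) (abs_nonneg _)
  have h6 := mul_nonneg (Nat.cast_nonneg (α := ℝ) n) (inner_sub_ballProj_nonneg (u.toH s) hv1)
  have h7 := (abs_le.1 h2).2
  set x := ‖u.toH s - v.toH s‖
  set y := ‖u.toV s - v.toV s‖
  set z := ‖v.toV s‖
  have h8 : 2 * (C * x * y) ≤ y ^ 2 / 2 + 2 * C ^ 2 * x ^ 2 := by
    nlinarith [sq_nonneg (2 * C * x - y)]
  have h9 : 2 * (c * y * x * z) ≤ y ^ 2 / 2 + 2 * c ^ 2 * z ^ 2 * x ^ 2 := by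
    nlinarith [sq_nonneg (2 * c * x * z - y)]
  nlinarith

/-- The quantitative estimate for the penalization error. -/
theorem exists_error_bound (hfσ : LipschitzCoeff 𝔸 f σ) (hB : BilinearAssumption 𝔸 B)
    (hu₀ : ‖u₀‖ ≤ 1) (hT : 0 < T) (hN : 0 < N) :
    ∃ K : ℝ, 0 ≤ K ∧ ∀ (n : ℕ), 1 ≤ n → ∀ k ∈ ctrlBall T N, ∀ u : XPath 𝔸 T,
      IsPenalizedSolution 𝔸 f σ B u₀ n k u → ∀ (v : XPath 𝔸 T) (L : ℝ → H),
      IsReflectedSolution 𝔸 f σ B u₀ k v L →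
        (∀ t ∈ Icc 0 T, ‖u.toH t - v.toH t‖ ^ 2 ≤ K / Real.sqrt n) ∧
        ∫ s in (0 : ℝ)..T, ‖u.toV s - v.toV s‖ ^ 2 ≤ K / Real.sqrt n := by
  obtain ⟨C, hC, hf, hσ, -, -⟩ := hfσ.exists_const
  obtain ⟨c, hc0, hc, -, -⟩ := hB.exists_const
  obtain ⟨E₁, hE₁, hpen⟩ := exists_penalized_bound hfσ hB hu₀ hT hN
  obtain ⟨E₂, hE₂, hrefl⟩ := exists_reflected_bound (T := T) hfσ hB hu₀ hN
  -- A bound for the integral of the Grönwall coefficient `b` below, uniform in the control: `E₂`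
  -- bounds v in L²(V), and the last bracket is Young's inequality with weight 1.
  set R := 2 * C ^ 2 * T + 2 * c ^ 2 * E₂ + 2 * C * (1 / 2 * (T - 0) + N / (2 * 1)) with hR
  have hR0 : 0 ≤ R := by rw [sub_zero] at hR; positivity
  obtain ⟨G, hG0, hG⟩ := exists_gronwall_const R
  -- The first summand is the Grönwall bound for the supremum; the second comes from inserting that
  -- bound back into the energy inequality at time T.
  refine ⟨G * (E₁ * E₂) + (E₁ * E₂ + G * (E₁ * E₂) * R), by positivity,
    fun n hn k hk u hu v L hv => ?_⟩
  have hq : 0 < Real.sqrt n := Real.sqrt_pos.2 (by exact_mod_cast hn)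
  set ε := E₁ / Real.sqrt n with hε
  have hε0 : 0 ≤ ε := by positivity
  have m0 : (0 : ℝ) ∈ Icc 0 T := ⟨le_rfl, hT.le⟩
  have mT : T ∈ Icc 0 T := ⟨hT.le, le_rfl⟩
  have hW : MemLp (fun s => u.toV s - v.toV s) 2 (volume.restrict (Icc 0 T)) :=
    u.memLp_toV.sub v.memLp_toV
  have hyc : ContinuousOn (fun s => ‖u.toH s - v.toH s‖ ^ 2) (Icc 0 T) :=
    (u.continuousOn_toH.sub v.continuousOn_toH).norm.pow 2
  set b : ℝ → ℝ := fun s => 2 * C ^ 2 + 2 * c ^ 2 * ‖v.toV s‖ ^ 2 + 2 * C * |k s| with hb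
  have hbi1 := (intervalIntegrable_norm_sq v.memLp_toV m0 mT).const_mul (2 * c ^ 2)
  have hbi2 := (ctrl_intervalIntegrable_abs k m0 mT).const_mul (2 * C)
  have hbi : IntervalIntegrable b volume 0 T :=
    (IntervalIntegrable.add (by simp) hbi1).add hbi2
  have hb0 : ∀ s ∈ Icc 0 T, 0 ≤ b s := fun s _ => by positivity
  have hbR : ∫ s in (0 : ℝ)..T, b s ≤ R := by
    have e : ∫ s in (0 : ℝ)..T, b s = (∫ s in (0 : ℝ)..T, (2 * C ^ 2 : ℝ)) +
        (∫ s in (0 : ℝ)..T, 2 * c ^ 2 * ‖v.toV s‖ ^ 2) + ∫ s in (0 : ℝ)..T, 2 * C * |k s| := by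
      rw [← intervalIntegral.integral_add (by simp) hbi1, ← intervalIntegral.integral_add
        (IntervalIntegrable.add (by simp) hbi1) hbi2]
    rw [e, intervalIntegral.integral_const, intervalIntegral.integral_const_mul,
      intervalIntegral.integral_const_mul, smul_eq_mul, sub_zero, hR]
    have h1 := mul_le_mul_of_nonneg_left (hrefl k hk v L hv T ⟨hT, le_rfl⟩).1
      (show 0 ≤ 2 * c ^ 2 by positivity)
    have h2 := mul_le_mul_of_nonneg_left (integral_abs_ctrl_le hk one_pos le_rfl hT.le le_rfl)
      (show 0 ≤ 2 * C by positivity)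
    linarith
  -- The dissipation is kept on the left: dropped, it leaves the Grönwall inequality, and kept at
  -- time T it yields the L²(V) estimate.
  have hmain : ∀ t ∈ Ioc 0 T, ‖u.toH t - v.toH t‖ ^ 2 +
      ∫ s in (0 : ℝ)..t, ‖u.toV s - v.toV s‖ ^ 2 ≤
        ε * E₂ + ∫ s in (0 : ℝ)..t, b s * ‖u.toH s - v.toH s‖ ^ 2 := by
    intro t ht
    have ht' : t ∈ Icc 0 T := Ioc_subset_Icc_self ht
    have h1 := energy_diff_le hfσ hB hu hv hε0 (hpen n hn k hk u hu) ht
      (hrefl k hk v L hv t ht).2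
    have i1 := intervalIntegrable_norm_sq hW m0 ht'
    have i2 : IntervalIntegrable (fun s => b s * ‖u.toH s - v.toH s‖ ^ 2) volume 0 t := by
      refine (hbi.mono_set ?_).mul_continuousOn (hyc.mono (uIcc_subset_Icc m0 ht'))
      rw [uIcc_of_le hT.le]
      exact uIcc_subset_Icc m0 ht'
    have i3 := intervalIntegrable_pairing
      ((memLp_penalizedDrift hfσ hB n k u).sub (memLp_drift hfσ hB k v)) hW m0 ht'
    have h2 : ∫ s in (0 : ℝ)..t, 2 * (penalizedDrift f σ B n k u s - drift f σ B k v s)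
        (u.toV s - v.toV s) ≤
        ∫ s in (0 : ℝ)..t, (b s * ‖u.toH s - v.toH s‖ ^ 2 - ‖u.toV s - v.toV s‖ ^ 2) := by
      refine intervalIntegral.integral_mono_ae_restrict ht.1.le (i3.const_mul 2) (i2.sub i1) ?_
      filter_upwards [ae_mono (Icc_zero_mono ht') u.ae_eq, ae_mono (Icc_zero_mono ht') v.ae_eq,
        ae_restrict_mem measurableSet_Icc] with s hs1 hs2 hs3
      have := two_mul_drift_diff_le hf hσ hB hc n k u v hs1 hs2
        (hv.mem_ball s ⟨hs3.1, hs3.2.trans ht.2⟩)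
      simp only [hb]
      linarith
    rw [intervalIntegral.integral_const_mul, intervalIntegral.integral_sub i2 i1] at h2
    linarith
  have hVnn : ∀ t ∈ Icc 0 T, 0 ≤ ∫ s in (0 : ℝ)..t, ‖u.toV s - v.toV s‖ ^ 2 := fun t ht =>
    intervalIntegral.integral_nonneg ht.1 fun _ _ => sq_nonneg _
  have hεE : 0 ≤ ε * E₂ := by positivity
  have hgr := hG T (ε * E₂) b (fun s => ‖u.toH s - v.toH s‖ ^ 2) hT.le hεE hbi hb0 hyc
    (fun s _ => sq_nonneg _) (fun t ht => by
      rcases eq_or_lt_of_le ht.1 with rfl | ht0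
      · rw [intervalIntegral.integral_same, hu.initial, hv.initial, sub_self, norm_zero]
        simpa using hεE
      · linarith [hmain t ⟨ht0, ht.2⟩, hVnn t ht]) hbR
  have hK : (G * (E₁ * E₂) + (E₁ * E₂ + G * (E₁ * E₂) * R)) / Real.sqrt n =
      G * (ε * E₂) + (ε * E₂ + G * (ε * E₂) * R) := by
    rw [hε]; ring
  have hGε : 0 ≤ G * (ε * E₂) := mul_nonneg hG0 hεE
  have hGR : 0 ≤ G * (ε * E₂) * R := mul_nonneg hGε hR0
  rw [hK]
  constructor
  · intro t ht
    have := hgr t ht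
    linarith
  · have h1 := hmain T ⟨hT, le_rfl⟩
    have h2 := integral_mul_le_of_le hT.le hbi hb0 hyc hgr
    have h3 := mul_le_mul_of_nonneg_left hbR hGε
    have h4 := sq_nonneg ‖u.toH T - v.toH T‖
    linarith

/-! ### From the real estimates to the distance of X_T and the limit -/

theorem enorm_sq_eq_ofReal {E : Type*} [NormedAddCommGroup E] (x : E) :
    ‖x‖ₑ ^ 2 = ENNReal.ofReal (‖x‖ ^ 2) := by
  rw [ENNReal.ofReal_pow (norm_nonneg _), ofReal_norm]

theorem XPath.dist_le_of_bounds {u v : XPath 𝔸 T} {K : ℝ} (hT : 0 ≤ T)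
    (h1 : ∀ t ∈ Icc 0 T, ‖u.toH t - v.toH t‖ ^ 2 ≤ K)
    (h2 : ∫ s in (0 : ℝ)..T, ‖u.toV s - v.toV s‖ ^ 2 ≤ K) :
    u.dist v ≤ (ENNReal.ofReal K + ENNReal.ofReal K) ^ (1 / 2 : ℝ) := by
  refine ENNReal.rpow_le_rpow (add_le_add ?_ ?_) (by norm_num)
  · refine iSup₂_le fun t ht => ?_
    rw [enorm_sq_eq_ofReal]
    exact ENNReal.ofReal_le_ofReal (h1 t ht)
  · have hW : MemLp (fun s => u.toV s - v.toV s) 2 (volume.restrict (Icc 0 T)) :=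
      u.memLp_toV.sub v.memLp_toV
    rw [intervalIntegral.integral_of_le hT, ← integral_Icc_eq_integral_Ioc] at h2
    simp_rw [enorm_sq_eq_ofReal]
    rw [← ofReal_integral_eq_lintegral_ofReal hW.norm.integrable_sq
      (Eventually.of_forall fun _ => sq_nonneg _)]
    exact ENNReal.ofReal_le_ofReal h2

end

end ReflectedSEE

end

theorem mainTheorem3 {H : Type*} [NormedAddCommGroup H] [InnerProductSpace ℝ H] [CompleteSpace H]
    [TopologicalSpace.SeparableSpace H] (𝔸 : ReflectedSEE.CoerciveOperator H)
    (f : H → 𝔸.Vdual) (σ : H → H) (hfσ : ReflectedSEE.LipschitzCoeff 𝔸 f σ)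
    (B : 𝔸.V →ₗ[ℝ] 𝔸.V →ₗ[ℝ] 𝔸.Vdual) (hB : ReflectedSEE.BilinearAssumption 𝔸 B)
    (u₀ : H) (hu₀ : ‖u₀‖ ≤ 1) (T : ℝ) (hT : 0 < T) (N : ℝ) (hN : 0 < N) :
    Tendsto
      (fun n : ℕ =>
        ⨆ (k : ReflectedSEE.Ctrl T) (_ : k ∈ ReflectedSEE.ctrlBall T N)
          (u : ReflectedSEE.XPath 𝔸 T)
          (_ : ReflectedSEE.IsPenalizedSolution 𝔸 f σ B u₀ n k u)
          (v : ReflectedSEE.XPath 𝔸 T) (L : ℝ → H)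
          (_ : ReflectedSEE.IsReflectedSolution 𝔸 f σ B u₀ k v L),
          u.dist v)
      atTop (𝓝 0) := by
  obtain ⟨K, hK0, hK⟩ := ReflectedSEE.exists_error_bound hfσ hB hu₀ hT hN
  have hsq : Tendsto (fun n : ℕ => Real.sqrt n) atTop atTop :=
    Real.tendsto_sqrt_atTop.comp tendsto_natCast_atTop_atTop
  have h1 : Tendsto (fun n : ℕ => ENNReal.ofReal (K / Real.sqrt n)) atTop (𝓝 0) := by
    have := ENNReal.tendsto_ofReal (hsq.const_div_atTop K)
    rwa [ENNReal.ofReal_zero] at this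
  have h2 : Tendsto (fun n : ℕ => (ENNReal.ofReal (K / Real.sqrt n) +
      ENNReal.ofReal (K / Real.sqrt n)) ^ (1 / 2 : ℝ)) atTop (𝓝 0) := by
    have := (h1.add h1).ennrpow_const (1 / 2 : ℝ)
    rwa [add_zero, ENNReal.zero_rpow_of_pos (by norm_num)] at this
  refine tendsto_of_tendsto_of_tendsto_of_le_of_le' tendsto_const_nhds h2
    (Eventually.of_forall fun n => zero_le) ?_
  -- The rate K/√n is only available for n ≥ 1; it does not depend on the control or on the
  -- solutions, so it bounds the whole supremum.
  filter_upwards [eventually_ge_atTop 1] with n hn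
  refine iSup₂_le fun k hk => iSup₂_le fun u hu => iSup₂_le fun v L => iSup_le fun hv => ?_
  obtain ⟨a, b⟩ := hK n hn k hk u hu v L hv
  exact ReflectedSEE.XPath.dist_le_of_bounds hT.le a b
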